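/- **Setting.** For a bi-infinite sequence $x\in\{1,3\}^{\mathbb Z}$ all of whose mono-symbol blocks (maximal runs of equal symbols) are finite, number the consecutive blocks by $\mathbb Z$, block $0$ being the one that contains the position $0$. The derivative $\Delta x$ is the sequence of the lengths of these blocks; $x$ is *differentiable* if $\Delta x$ is defined and belongs to $\{1,3\}^{\mathbb Z}$, and *smooth* if $x,\Delta x,\Delta^2x,\dots$ are all differentiable. The recoding $\mathrm{rec}(x)\in\mathcal A^{\mathbb Z}$, $\mathcal A=\{A,B,C,D\}$, of a differentiable $x$ has as $k$-th letter the code of the $k$-th block of $x$, where $A=1$, $B=3$, $C=111$, $D=333$. A differentiable sequence $x$ is of type $0$ if $\mathrm{rec}(x)$ contains a factor $ABA$ or $DCD$, and of type $1$ if it contains a factor $BAB$ or $CDC$ (every smooth sequence has exactly one type). For $\tau\in\{0,1\}^{\mathbb N}$ let $X_\tau$ be the set of smooth sequences $x$ such that $\Delta^nx$ is of type $\tau_n$ for all $n\ge0$, and let $Y_\tau=\mathrm{rec}(X_\tau)$. Let $S$ be the shift, $(Sy)_n=y_{n+1}$. For $w=w_0\cdots w_{\ell-1}\in\mathcal A^*$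 put $[w]=\{y\in\mathcal A^{\mathbb Z}: y_i=w_i,\ 0\le i<\ell\}$, and let $|y|^{[1,n]}_w$ be the number of occurrences of $w$ in the finite word $y_1\cdots y_n$. **Proposition.** Let $\tau\in\{0,1\}^{\mathbb N}$. 1. There are numbers $v_\tau(w)$, $w\in\mathcal A^*$, such that the following holds. Let $y\in Y_\tau$, let $(n_k)$ be a strictly increasing sequence of positive integers and let $\nu$ be a Borel probability measure with $$\frac1{n_k}\sum_{j=1}^{n_k}\delta_{S^jy}\ \xrightarrow[k\to\infty]{}\ \nu\quad\text{weakly}.$$ Then, for every $w\in\mathcal A^*$, $$\nu([w])=\lim_{k\to\infty}\frac1{n_k}|y|^{[1,n_k]}_w=v_\tau(w).$$ So this value depends only on $\tau$ and $w$, and neither on $(n_k)$ nor on $y$. 2. There is a unique Borel probability measure $\nu_\tau$ such that $$\forall y\in Y_\tau,\qquad \frac1n\sum_{j=1}^n\delta_{S^jy}\ \xrightarrow[n\to\infty]{}\ \nu_\tau\quad\text{weakly}.$$ 3. $Y_\tau$ is a subshift (nonempty, closed, $S(Y_\tau)=Y_\tau$), and it is uniquely ergodic: $\nu_\tau$ is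 the only $S$-invariant Borel probability measure on $Y_\tau$. -/

import Mathlib

open Filter Topology MeasureTheory
open scoped ENNReal NNReal

noncomputable section

namespace SmoothSeq

/-! ### Bi-infinite sequences over `{1, 3}`, derivative and smoothness -/

/-- `x ∈ {1, 3}^ℤ`. -/
def Over13 (x : ℤ → ℕ) : Prop := ∀ n, x n = 1 ∨ x n = 3

/-- `p` enumerates, in increasing order, the starting positions of the consecutive mono-symbol
blocks of `x`, the block with number `0` being the one that contains the position `0`.
The block with number `k` is `x` restricted to `[p k, p (k + 1))`. Such a `p` exists if and only
if all the mono-symbol blocks of `x` are finite. -/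
structure IsBlockStarts (x : ℤ → ℕ) (p : ℤ → ℤ) : Prop where
  strictMono : StrictMono p
  zero_le : p 0 ≤ 0
  zero_lt : 0 < p 1
  const : ∀ k n, p k ≤ n → n < p (k + 1) → x n = x (p k)
  change : ∀ k, x (p (k + 1)) ≠ x (p k)

theorem IsBlockStarts.iff_start {x : ℤ → ℕ} {p : ℤ → ℤ} (h : IsBlockStarts x p) (n : ℤ) :
    (∃ k, p k = n) ↔ x n ≠ x (n - 1) := by
  constructor
  · rintro ⟨k, rfl⟩
    have h1 : p (k - 1) < p k := h.strictMono (by omega)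
    have h2 := h.const (k - 1) (p k - 1) (by omega) (by rw [sub_add_cancel]; omega)
    have h3 := h.change (k - 1)
    rw [sub_add_cancel] at h3
    rwa [h2]
  · intro hn
    have hup : ∀ m : ℕ, p 0 + m ≤ p m := by
      intro m
      induction m with
      | zero => simp
      | succ m ih =>
        have : p m < p (m + 1 : ℕ) := h.strictMono (by push_cast; omega)
        push_cast at this ⊢
        omega
    have hdown : ∀ m : ℕ, p (-m) ≤ p 0 - m := by
      intro m
      induction m with
      | zero => simp
      | succ m ih =>
        have : p (-(m + 1 : ℕ)) < p (-m) := h.strictMono (by push_cast; omega)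
        push_cast at this ⊢
        omega
    obtain ⟨k, hk, hmax⟩ : ∃ k, p k ≤ n ∧ ∀ l, p l ≤ n → l ≤ k := by
      apply Int.exists_greatest_of_bdd
      · refine ⟨((n - p 0).toNat + 1 : ℕ), fun l hl => ?_⟩
        have := hup ((n - p 0).toNat + 1)
        by_contra hlt
        have h4 := h.strictMono.monotone (not_le.1 hlt).le
        push_cast at *
        omega
      · refine ⟨-((p 0 - n).toNat : ℕ), ?_⟩
        have := hdown (p 0 - n).toNat
        omega
    have hlt : n < p (k + 1) := by
      by_contra hc
      have := hmax (k + 1) (not_lt.1 hc)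
      omega
    refine ⟨k, ?_⟩
    by_contra hne
    have hlt' : p k < n := lt_of_le_of_ne hk hne
    exact hn ((h.const k n hk hlt).trans (h.const k (n - 1) (by omega) (by omega)).symm)

/-- The enumeration of the blocks is unique. -/
theorem IsBlockStarts.unique {x : ℤ → ℕ} {p q : ℤ → ℤ} (hp : IsBlockStarts x p)
    (hq : IsBlockStarts x q) : p = q := by
  have key : ∀ {p q : ℤ → ℤ}, IsBlockStarts x p → IsBlockStarts x q →
      ∀ k, ∃ l, q l = p k := fun hp hq k =>
    (hq.iff_start _).2 ((hp.iff_start _).1 ⟨k, rfl⟩)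
  choose f hf using key hp hq
  choose g hg using key hq hp
  have hfm : StrictMono f := fun a b hab => by
    have := hp.strictMono hab
    rw [← hf a, ← hf b] at this
    exact hq.strictMono.lt_iff_lt.1 this
  have hgf : ∀ k, g (f k) = k := fun k => hp.strictMono.injective (by rw [hg, hf])
  have hfg : ∀ k, f (g k) = k := fun k => hq.strictMono.injective (by rw [hf, hg])
  have hf0 : f 0 = 0 := by
    have h1 : f 0 < 1 := by
      apply hq.strictMono.lt_iff_lt.1
      rw [hf]
      exact lt_of_le_of_lt hp.zero_le hq.zero_lt
    have h2 : 0 < f 1 := by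
      apply hq.strictMono.lt_iff_lt.1
      rw [hf]
      exact lt_of_le_of_lt hq.zero_le hp.zero_lt
    have h3 : ¬ f 0 < 0 := by
      intro hlt
      have h4 : 0 < g 0 := by
        apply hfm.lt_iff_lt.1
        rw [hfg]; exact hlt
      have h5 : g 0 < 1 := by
        apply hfm.lt_iff_lt.1
        rw [hfg]; exact h2
      omega
    omega
  have hstep : ∀ k, f (k + 1) = f k + 1 := by
    intro k
    have h1 : f k < f (k + 1) := hfm (by omega)
    by_contra hne
    have h2 : k < g (f k + 1) := by
      apply hfm.lt_iff_lt.1; rw [hfg]; omega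
    have h3 : g (f k + 1) < k + 1 := by
      apply hfm.lt_iff_lt.1; rw [hfg]; omega
    omega
  have hid : ∀ k, f k = k := by
    intro k
    induction k using Int.induction_on with
    | zero => exact hf0
    | succ i ih => rw [hstep, ih]
    | pred i ih =>
      have := hstep (-(i : ℤ) - 1)
      rw [sub_add_cancel, ih] at this
      omega
  funext k
  rw [← hf k, hid k]

open Classical in
/-- The starting positions of the mono-symbol blocks of `x` (junk value `0` if some block of `x`
is infinite). -/
def blockStart (x : ℤ → ℕ) : ℤ → ℤ :=
  if h : ∃ p, IsBlockStarts x p then h.choose else 0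

theorem IsBlockStarts.blockStart_eq {x : ℤ → ℕ} {p : ℤ → ℤ} (h : IsBlockStarts x p) :
    blockStart x = p := by
  have h' : ∃ p, IsBlockStarts x p := ⟨p, h⟩
  rw [blockStart, dif_pos h']
  exact h'.choose_spec.unique h

/-- The derivative `Δ x`: the sequence of the lengths of the consecutive mono-symbol blocks of `x`,
`(Δ x) 0` being the length of the block that contains the position `0`. -/
def derivSeq (x : ℤ → ℕ) : ℤ → ℕ :=
  fun k => (blockStart x (k + 1) - blockStart x k).toNat

/-- `x` is differentiable: `Δ x` is well defined and belongs to `{1, 3}^ℤ`. -/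
def IsDifferentiable (x : ℤ → ℕ) : Prop :=
  (∃ p, IsBlockStarts x p) ∧ Over13 (derivSeq x)

/-- The set `X` of bi-infinite smooth sequences over `{1, 3}`. -/
def smoothSet : Set (ℤ → ℕ) :=
  {x | Over13 x ∧ ∀ n : ℕ, IsDifferentiable (derivSeq^[n] x)}

/-! ### Recoding -/

/-- The alphabet `{A, B, C, D}`, where `A = 1`, `B = 3`, `C = 111`, `D = 333`. -/
inductive Letter where
  | A | B | C | D
  deriving DecidableEq

instance : Fintype Letter :=
  ⟨{.A, .B, .C, .D}, fun x => by cases x <;> simp⟩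

instance : TopologicalSpace Letter := ⊥
instance : DiscreteTopology Letter := ⟨rfl⟩
instance : MeasurableSpace Letter := ⊤
instance : DiscreteMeasurableSpace Letter := ⟨fun _ => trivial⟩

/-- The letter that codes the block formed by `ℓ` copies of the symbol `a`,
for `a, ℓ ∈ {1, 3}`. -/
def encode (a ℓ : ℕ) : Letter :=
  if ℓ = 1 then (if a = 1 then .A else .B) else (if a = 1 then .C else .D)

/-- The recoding `rec x`: its `k`-th letter codes the `k`-th mono-symbol block of `x`, the block
with number `0` being the one that contains the position `0`. -/
def recode (x : ℤ → ℕ) : ℤ → Letter :=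
  fun k => encode (x (blockStart x k)) (derivSeq x k)

/-- The word `w` occurs in `y` at the position `i`. -/
def OccursAt (w : List Letter) (y : ℤ → Letter) (i : ℤ) : Prop :=
  ∀ k : Fin w.length, y (i + (k : ℕ)) = w.get k

/-- `w` is a factor of `y`. -/
def IsFactor (w : List Letter) (y : ℤ → Letter) : Prop := ∃ i, OccursAt w y i

/-- `y` is of type `0` if it contains an elementary block `ABA` or `DCD`, and of type `1` if it
contains an elementary block `BAB` or `CDC`. -/
def IsOfType (y : ℤ → Letter) (t : Fin 2) : Prop :=
  if t = 0 then IsFactor [.A, .B, .A] y ∨ IsFactor [.D, .C, .D] y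
  else IsFactor [.B, .A, .B] y ∨ IsFactor [.C, .D, .C] y

/-- The set `X_τ` of the smooth sequences `x` such that, for every `n`, the derivative `Δⁿ x`
(equivalently, its recoding) is of type `τ n`. -/
def smoothSetOfType (τ : ℕ → Fin 2) : Set (ℤ → ℕ) :=
  {x | x ∈ smoothSet ∧ ∀ n : ℕ, IsOfType (recode (derivSeq^[n] x)) (τ n)}

/-- `Y_τ = rec (X_τ)`. -/
def recodedSet (τ : ℕ → Fin 2) : Set (ℤ → Letter) := recode '' smoothSetOfType τ

/-! ### Symbolic dynamics on `{A, B, C, D}^ℤ` -/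

/-- The shift map, `(S y) n = y (n + 1)`. -/
def shift (y : ℤ → Letter) : ℤ → Letter := fun n => y (n + 1)

/-- The cylinder set `[w]`. -/
def wordCylinder (w : List Letter) : Set (ℤ → Letter) := {y | OccursAt w y 0}

open Classical in
/-- The number of occurrences of `w` in the finite word `y₁ y₂ ⋯ yₙ`. -/
def occurrences (w : List Letter) (y : ℤ → Letter) (n : ℕ) : ℕ :=
  ((Finset.Icc 1 n).filter fun j => j + w.length ≤ n + 1 ∧ OccursAt w y j).card

/-- The empirical measure `(1 / n) ∑_{j = 1}^n δ_{S^j y}`, for `n ≥ 1`. -/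
def empiricalMeasure (y : ℤ → Letter) (n : ℕ+) : ProbabilityMeasure (ℤ → Letter) :=
  ⟨((n : ℕ) : ℝ≥0∞)⁻¹ • ∑ j ∈ Finset.Icc 1 (n : ℕ), Measure.dirac (shift^[j] y), ⟨by
    simp only [Measure.smul_apply, Measure.finsetSum_apply, measure_univ, smul_eq_mul,
      Finset.sum_const, Nat.card_Icc, Nat.add_sub_cancel, nsmul_eq_mul, mul_one]
    exact ENNReal.inv_mul_cancel (by simp) (ENNReal.natCast_ne_top _)⟩⟩

/-- A subshift: a nonempty closed set `Z` with `S (Z) = Z`. -/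
def IsSubshift (Z : Set (ℤ → Letter)) : Prop :=
  Z.Nonempty ∧ IsClosed Z ∧ shift '' Z = Z

/-- The shift-invariant Borel probability measures on `Z`, seen as measures on `{A, B, C, D}^ℤ`
that give mass `1` to `Z`. -/
def invariantMeasures (Z : Set (ℤ → Letter)) : Set (ProbabilityMeasure (ℤ → Letter)) :=
  {μ | μ Z = 1 ∧ MeasurePreserving shift (μ : Measure (ℤ → Letter)) (μ : Measure (ℤ → Letter))}

end SmoothSeq

end

open SmoothSeq

namespace SmoothSeq

/-! A sequence belongs to `recodedSet τ` exactly when it can be desubstituted forever, the step at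
level `n` using the substitution `sub (τ n)` (`mem_recodedSet_iff`). Indeed, the lengths of the
letters of `y = rec x` form `Δx`, so each block of `Δx` groups one or three consecutive letters of
`y` of equal length and alternating symbols. Block lengths are odd, hence one parity `t` governs all
the groups, and it is the type of `y`. Every `y` is thus cut, at each level `m`, into words `word τ
m a` that depend only on `τ`.

Frequencies are handled through finitely additive, translation invariant probabilities on `ℤ`.
Ultrafilter limits of averages are of this kind, so the averages of a set converge as soon as all
these probabilities agree on it (`tendsto_average`). For such a density, let `s`, `c`, `q` be the
densities of the starts of the level-`m` blocks coded by `A` or `C`, by `C`, and by `D`. Counting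
letters inside images gives a nonnegative linear recurrence expressing level `m` in terms of level
`m + 1` (`IsTower.isFreq`). On the ratios `c / s`, `q / s` it acts by projective maps that contract
the sup distance by `2 / 3`. Ratios stay in `[0, 1]`, so pulling back from level `m + n` and letting
`n` grow determines them; the normalization `s 0 = 1 / 2` determines the rest (`IsFreq.eq`).
Moreover `s m` tends to `0`.

An occurrence of a word `w` either lies inside a level-`m` block, where it is counted by `τ` and the
block densities, or starts near the end of one. The second kind has density at most `2 |w| s m`, so
the frequency of `w` depends only on `τ` and `w` (`density_occursAt_eq`).

Cylinders are clopen and determine measures, so every limit of empirical measures is the same.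
Integrating the averages against an invariant measure gives it the same cylinder values
(`apply_cylinderAt_of_invariant`). Closedness and nonemptiness come from compactness of the space of
towers with bounded offsets (`recodedSet_eq_image`). -/

/-! ### Letters -/

/-- Whether the block coded by a letter consists of symbols `3`. -/
def Letter.sym : Letter → Bool
  | .A => false | .B => true | .C => false | .D => true

/-- Whether the block coded by a letter has length `3`. -/
def Letter.long : Letter → Bool
  | .A => false | .B => false | .C => true | .D => true

/-- The letter with given symbol and length. -/
def Letter.mk : Bool → Bool → Letter
  | false, false => .A | true, false => .B | false, true => .C | true, true => .D

/-- The symbol of `{1, 3}` that corresponds to a Boolean. -/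
def val (b : Bool) : ℕ := if b then 3 else 1

/-- The length of the block coded by a letter. -/
def Letter.len (a : Letter) : ℕ := val a.long

@[simp] theorem Letter.sym_mk (s l : Bool) : (Letter.mk s l).sym = s := by
  cases s <;> cases l <;> rfl

@[simp] theorem Letter.long_mk (s l : Bool) : (Letter.mk s l).long = l := by
  cases s <;> cases l <;> rfl

theorem Letter.eq_of {a b : Letter} (h : a.sym = b.sym) (h' : a.long = b.long) : a = b := by
  cases a <;> cases b <;> simp_all [Letter.sym, Letter.long]

theorem val_injective : Function.Injective val := by
  intro a b h
  cases a <;> cases b <;> simp_all [val]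

theorem val_pos (b : Bool) : 0 < val b := by cases b <;> simp [val]

theorem Letter.len_pos (a : Letter) : 0 < a.len := val_pos _

theorem Letter.len_le (a : Letter) : a.len ≤ 3 := by cases a <;> simp [Letter.len, Letter.long, val]

theorem encode_val (s l : Bool) : encode (val s) (val l) = Letter.mk s l := by
  cases s <;> cases l <;> rfl

theorem exists_val {n : ℕ} (h : n = 1 ∨ n = 3) : ∃ b, val b = n := by
  rcases h with rfl | rfl
  · exact ⟨false, rfl⟩
  · exact ⟨true, rfl⟩

/-- The `r`-th letter of the image of the letter `b` under the substitution
`A ↦ A, B ↦ D, C ↦ ABA, D ↦ DCD` (for `t = 0`) or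
`A ↦ B, B ↦ C, C ↦ BAB, D ↦ CDC` (for `t = 1`). -/
def sub (t : Fin 2) (b : Letter) (r : ℕ) : Letter :=
  .mk ((b.sym ^^ decide (t = 1)) ^^ decide (r % 2 = 1)) b.sym

/-- The symbols of the letters of `y` alternate. -/
def Alternating (y : ℤ → Letter) : Prop := ∀ k, (y (k + 1)).sym = !(y k).sym

theorem Alternating.sym_add {y : ℤ → Letter} (h : Alternating y) (k : ℤ) (r : ℕ) :
    (y (k + r)).sym = ((y k).sym ^^ decide (r % 2 = 1)) := by
  induction r with
  | zero => simp
  | succ r ih =>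
    rw [Nat.cast_succ, ← add_assoc, h, ih]
    rcases Nat.mod_two_eq_zero_or_one r with h0 | h0 <;> simp [h0, Nat.add_mod]

/-! ### Partitions of `ℤ` into consecutive intervals -/

/-- `p` enumerates the starting points of consecutive intervals of lengths `L k`. -/
structure IsPartition (p : ℤ → ℤ) (L : ℤ → ℕ) : Prop where
  pos : ∀ k, 0 < L k
  step : ∀ k, p (k + 1) = p k + L k

theorem IsPartition.strictMono {p : ℤ → ℤ} {L : ℤ → ℕ} (h : IsPartition p L) : StrictMono p := by
  refine strictMono_int_of_lt_succ fun k => ?_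
  have := h.pos k
  rw [h.step]; omega

theorem IsPartition.cover {p : ℤ → ℤ} {L : ℤ → ℕ} (h : IsPartition p L) (i : ℤ) :
    ∃ k, ∃ r < L k, i = p k + (r : ℕ) := by
  obtain ⟨k, hk, hk'⟩ : ∃ k, p k ≤ i ∧ i < p (k + 1) := by
    have hup : ∀ m : ℕ, p 0 + m ≤ p m := by
      intro m
      induction m with
      | zero => simp
      | succ m ih =>
        have := h.strictMono (show (m : ℤ) < (m + 1 : ℕ) by push_cast; omega)
        push_cast at this ⊢
        omega
    have hdown : ∀ m : ℕ, p (-m) ≤ p 0 - m := by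
      intro m
      induction m with
      | zero => simp
      | succ m ih =>
        have : p (-(m + 1 : ℕ)) < p (-m) := h.strictMono (by push_cast; omega)
        push_cast at this ⊢
        omega
    obtain ⟨k, hk, hmax⟩ : ∃ k, p k ≤ i ∧ ∀ l, p l ≤ i → l ≤ k := by
      apply Int.exists_greatest_of_bdd
      · refine ⟨((i - p 0).toNat + 1 : ℕ), fun l hl => ?_⟩
        have := hup ((i - p 0).toNat + 1)
        by_contra hlt
        have h4 := h.strictMono.monotone (not_le.1 hlt).le
        push_cast at *
        omega
      · refine ⟨-((p 0 - i).toNat : ℕ), ?_⟩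
        have := hdown (p 0 - i).toNat
        omega
    refine ⟨k, hk, ?_⟩
    by_contra hc
    have := hmax (k + 1) (not_lt.1 hc)
    omega
  rw [h.step] at hk'
  exact ⟨k, (i - p k).toNat, by omega, by omega⟩

theorem IsPartition.unique {p : ℤ → ℤ} {L : ℤ → ℕ} (h : IsPartition p L) {k l : ℤ} {r s : ℕ}
    (hr : r < L k) (hs : s < L l) (he : p k + (r : ℤ) = p l + s) : k = l ∧ r = s := by
  have key : ∀ {k l : ℤ} {r s : ℕ}, r < L k → p k + (r : ℤ) = p l + s → ¬ k < l := by
    intro k l r s hr he hlt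
    have h1 := h.strictMono.monotone (show k + 1 ≤ l by omega)
    rw [h.step] at h1
    omega
  have hkl : k = l := le_antisymm (not_lt.1 (key hs he.symm)) (not_lt.1 (key hr he))
  -- Each of the two intervals is excluded from lying strictly before the other, so only the offsets
  -- remain to be compared.
  subst hkl
  exact ⟨rfl, by omega⟩

theorem IsPartition.exists_fun {p : ℤ → ℤ} {L : ℤ → ℕ} (h : IsPartition p L) {α : Type*}
    (g : ℤ → ℕ → α) : ∃ y : ℤ → α, ∀ k, ∀ r < L k, y (p k + (r : ℕ)) = g k r := by
  choose K R hR hKR using h.cover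
  refine ⟨fun i => g (K i) (R i), fun k r hr => ?_⟩
  obtain ⟨h1, h2⟩ := h.unique hr (hR _) (hKR (p k + r))
  exact congrArg₂ g h1.symm h2.symm

/-- The starting points of the intervals of lengths `|z k|`, the interval `0` starting at `0`. -/
noncomputable def starts (z : ℤ → Letter) (k : ℤ) : ℤ :=
  ∑ i ∈ Finset.Ico 0 k, ((z i).len : ℤ) - ∑ i ∈ Finset.Ico k 0, ((z i).len : ℤ)

@[simp] theorem starts_zero (z : ℤ → Letter) : starts z 0 = 0 := by simp [starts]

theorem isPartition_starts (z : ℤ → Letter) : IsPartition (starts z) (fun k => (z k).len) := by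
  refine ⟨fun k => Letter.len_pos _, fun k => ?_⟩
  unfold starts
  rcases le_or_gt 0 k with hk | hk
  · have h1 : Finset.Ico 0 (k + 1) = insert k (Finset.Ico 0 k) := by
      ext i; simp only [Finset.mem_Ico, Finset.mem_insert]; omega
    rw [h1, Finset.sum_insert (by simp), Finset.Ico_eq_empty (a := k) (by omega),
      Finset.Ico_eq_empty (a := k + 1) (by omega)]
    simp [add_comm]
  · have h1 : Finset.Ico k 0 = insert k (Finset.Ico (k + 1) 0) := by
      ext i; simp only [Finset.mem_Ico, Finset.mem_insert]; omega
    rw [h1, Finset.sum_insert (by simp), Finset.Ico_eq_empty (b := k) (by omega),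
      Finset.Ico_eq_empty (b := k + 1) (by omega)]
    simp

/-! ### Sequences coded by their blocks -/

/-- The blocks of `x` start at the `p k`, and are coded by the `z k`. -/
structure IsCoding (x : ℤ → ℕ) (z : ℤ → Letter) (p : ℤ → ℤ) : Prop where
  alt : Alternating z
  part : IsPartition p (fun k => (z k).len)
  zero_le : p 0 ≤ 0
  zero_lt : 0 < p 1
  apply : ∀ k, ∀ r < (z k).len, x (p k + (r : ℕ)) = val (z k).sym

theorem IsCoding.apply_start {x : ℤ → ℕ} {z : ℤ → Letter} {p : ℤ → ℤ} (h : IsCoding x z p)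
    (k : ℤ) : x (p k) = val (z k).sym := by
  simpa using h.apply k 0 (Letter.len_pos _)

theorem IsCoding.isBlockStarts {x : ℤ → ℕ} {z : ℤ → Letter} {p : ℤ → ℤ} (h : IsCoding x z p) :
    IsBlockStarts x p where
  strictMono := h.part.strictMono
  zero_le := h.zero_le
  zero_lt := h.zero_lt
  const k n h1 h2 := by
    have h3 := h.part.step k
    have h4 := h.apply k (n - p k).toNat (by omega)
    rw [h.apply_start, ← h4]
    congr 1
    omega
  change k := by
    rw [h.apply_start, h.apply_start, h.alt]
    exact fun he => by simpa using val_injective he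

theorem IsCoding.derivSeq_eq {x : ℤ → ℕ} {z : ℤ → Letter} {p : ℤ → ℤ} (h : IsCoding x z p) :
    derivSeq x = fun k => (z k).len := by
  funext k
  rw [derivSeq, h.isBlockStarts.blockStart_eq, h.part.step]
  simp

theorem IsCoding.recode_eq {x : ℤ → ℕ} {z : ℤ → Letter} {p : ℤ → ℤ} (h : IsCoding x z p) :
    recode x = z := by
  funext k
  rw [recode, h.derivSeq_eq, h.isBlockStarts.blockStart_eq, h.apply_start]
  simp only [Letter.len]
  rw [encode_val]
  exact Letter.eq_of (by simp) (by simp)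

theorem over13_val (f : ℤ → Bool) : Over13 fun k => val (f k) := by
  intro k
  cases h : f k <;> simp [val, h]

theorem IsCoding.isDifferentiable {x : ℤ → ℕ} {z : ℤ → Letter} {p : ℤ → ℤ} (h : IsCoding x z p) :
    IsDifferentiable x :=
  ⟨⟨p, h.isBlockStarts⟩, by rw [h.derivSeq_eq]; exact over13_val _⟩

theorem IsDifferentiable.isCoding {x : ℤ → ℕ} (hx : Over13 x) (h : IsDifferentiable x) :
    IsCoding x (recode x) (blockStart x) := by
  obtain ⟨⟨p, hp⟩, hd⟩ := h
  have hb := hp.blockStart_eq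
  have hlen : ∀ k, ((recode x k).len : ℤ) = p (k + 1) - p k := by
    intro k
    have h1 := hp.strictMono (show k < k + 1 by omega)
    obtain ⟨s, hs⟩ := exists_val (hx (p k))
    obtain ⟨l, hl⟩ := exists_val (hd k)
    have h2 : (recode x k).len = derivSeq x k := by
      rw [recode, hb, ← hs, ← hl, encode_val, Letter.len, Letter.long_mk]
    rw [h2, derivSeq, hb]
    omega
  have hsym : ∀ k, x (p k) = val (recode x k).sym := by
    intro k
    obtain ⟨s, hs⟩ := exists_val (hx (p k))
    obtain ⟨l, hl⟩ := exists_val (hd k)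
    rw [recode, hb, ← hs, ← hl, encode_val, Letter.sym_mk]
  rw [hb]
  refine ⟨fun k => ?_, ⟨fun k => Letter.len_pos _, fun k => ?_⟩, hp.zero_le, hp.zero_lt,
    fun k r hr => ?_⟩
  · have := hp.change k
    rw [hsym, hsym] at this
    exact Bool.eq_not_of_ne fun he => this (congrArg val he)
  · rw [hlen]; ring
  · have := hlen k
    rw [hp.const k _ (by omega) (by omega), hsym]

/-! ### Towers of desubstitutions -/

/-- `y` is the concatenation of the images of the letters of `z` under the substitution `sub t`,
the image of `z k` starting at the position `p k`. -/
structure IsDesub (t : Fin 2) (y z : ℤ → Letter) (p : ℤ → ℤ) : Prop where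
  part : IsPartition p (fun k => (z k).len)
  apply : ∀ k, ∀ r < (z k).len, y (p k + (r : ℕ)) = sub t (z k) r

/-- An infinite sequence of successive desubstitutions of `z 0`. -/
structure IsTower (τ : ℕ → Fin 2) (z : ℕ → ℤ → Letter) (p : ℕ → ℤ → ℤ) : Prop where
  alt : ∀ n, Alternating (z n)
  desub : ∀ n, IsDesub (τ n) (z n) (z (n + 1)) (p n)

theorem IsDesub.shift {t : Fin 2} {y z : ℤ → Letter} {p : ℤ → ℤ} (h : IsDesub t y z p)
    (i k : ℤ) : IsDesub t (fun l => y (l + i)) (fun l => z (l + k)) (fun l => p (l + k) - i) where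
  part := ⟨fun _ => Letter.len_pos _, fun l => by
    have := h.part.step (l + k)
    rw [add_right_comm, this]; ring⟩
  apply l r hr := by
    rw [← h.apply _ _ hr]
    congr 1
    ring

/-- Translating one level forces a renumbering of all the higher ones: at each level, the block
numbered `0` must become the one that contains the chosen position of the level below. -/
theorem IsTower.exists_normalized {τ : ℕ → Fin 2} {z : ℕ → ℤ → Letter} {p : ℕ → ℤ → ℤ}
    (h : IsTower τ z p) (i : ℤ) : ∃ z' p', IsTower τ z' p' ∧ (z' 0 = fun l => z 0 (l + i)) ∧
      ∀ n, p' n 0 ≤ 0 ∧ 0 < p' n 1 := by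
  choose K R hR hKR using fun n => (h.desub n).part.cover
  -- `I n` is the number, at level `n`, of the letter lying above position `i` of level `0`.
  let I : ℕ → ℤ := fun n => Nat.rec i (fun n c => K n c) n
  have hI : ∀ n, I (n + 1) = K n (I n) := fun n => rfl
  refine ⟨fun n l => z n (l + I n), fun n l => p n (l + I (n + 1)) - I n,
    ⟨fun n k => ?_, fun n => (h.desub n).shift _ _⟩, rfl, fun n => ?_⟩
  · have := h.alt n (k + I n)
    rwa [add_right_comm] at this
  · have h1 := hR n (I n)
    have h2 := hKR n (I n)
    have h3 := (h.desub n).part.step (K n (I n))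
    beta_reduce
    rw [hI, zero_add, add_comm 1, h3]
    constructor
    · omega
    · omega

/-! ### From towers to smooth sequences -/

theorem IsDesub.exists_long {t : Fin 2} {y z : ℤ → Letter} {p : ℤ → ℤ} (h : IsDesub t y z p)
    (hz : Alternating z) : ∃ k, (y k).long = true := by
  have key : ∀ k, (y (p k)).long = (z k).sym := fun k => by
    have := h.apply k 0 (Letter.len_pos _)
    simp only [Nat.cast_zero, add_zero] at this
    rw [this]; simp [sub]
  by_cases h0 : (z 0).sym = true
  · exact ⟨_, (key 0).trans h0⟩
  · refine ⟨p 1, ?_⟩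
    rw [key, show (1 : ℤ) = 0 + 1 by rfl, hz]
    simpa using h0

theorem occursAt_triple {a b c : Letter} {y : ℤ → Letter} {i : ℤ} :
    OccursAt [a, b, c] y i ↔ y i = a ∧ y (i + 1) = b ∧ y (i + 2) = c := by
  constructor
  · intro h
    have h0 := h ⟨0, by simp⟩
    have h1 := h ⟨1, by simp⟩
    have h2 := h ⟨2, by simp⟩
    simp at h0 h1 h2
    exact ⟨h0, h1, h2⟩
  · rintro ⟨h0, h1, h2⟩ k
    obtain ⟨k, hk⟩ := k
    simp at hk
    interval_cases k <;> simp_all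

/-- The level above contains a long letter, because it can itself be desubstituted; the image of a
long letter is an elementary block of type `τ n`. -/
theorem IsTower.isOfType {τ : ℕ → Fin 2} {z : ℕ → ℤ → Letter} {p : ℕ → ℤ → ℤ}
    (h : IsTower τ z p) (n : ℕ) : IsOfType (z n) (τ n) := by
  obtain ⟨k, hk⟩ := (h.desub (n + 1)).exists_long (h.alt (n + 2))
  have hlen : (z (n + 1) k).len = 3 := by simp [Letter.len, hk, val]
  have h0 := (h.desub n).apply k 0 (by omega)
  have h1 := (h.desub n).apply k 1 (by omega)
  have h2 := (h.desub n).apply k 2 (by omega)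
  simp only [Nat.cast_zero, add_zero, Nat.cast_one, Nat.cast_ofNat] at h0 h1 h2
  have ht : τ n = 0 ∨ τ n = 1 := by omega
  rcases ht with ht | ht <;> rw [ht] at h0 h1 h2 ⊢ <;> simp only [IsOfType, if_pos, IsFactor,
    occursAt_triple, one_ne_zero, if_false] <;>
    cases hz : z (n + 1) k <;> simp_all [Letter.long, sub, Letter.sym, Letter.mk]
  · exact .inl ⟨_, h0, h1, h2⟩
  · exact .inr ⟨_, h0, h1, h2⟩
  · exact .inl ⟨_, h0, h1, h2⟩
  · exact .inr ⟨_, h0, h1, h2⟩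

/-- The sequence `x` is rebuilt by writing out the blocks coded by `z 0`; inductively, `z n` codes
the `n`-th derivative. The condition on `p n` matches the convention that block `0` contains
position `0`. -/
theorem IsTower.mem_recodedSet {τ : ℕ → Fin 2} {z : ℕ → ℤ → Letter} {p : ℕ → ℤ → ℤ}
    (h : IsTower τ z p) (hp : ∀ n, p n 0 ≤ 0 ∧ 0 < p n 1) : z 0 ∈ recodedSet τ := by
  obtain ⟨x, hx⟩ := (isPartition_starts (z 0)).exists_fun fun k _ => val (z 0 k).sym
  have hc0 : IsCoding x (z 0) (starts (z 0)) :=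
    ⟨h.alt 0, isPartition_starts _, by simp, by
      have := (isPartition_starts (z 0)).strictMono (show (0 : ℤ) < 1 by omega)
      simpa using this, hx⟩
  have hc : ∀ n, ∃ q, IsCoding (derivSeq^[n] x) (z n) q := by
    intro n
    induction n with
    | zero => exact ⟨_, hc0⟩
    | succ n ih =>
      obtain ⟨q, hq⟩ := ih
      refine ⟨p n, h.alt _, (h.desub n).part, (hp n).1, (hp n).2, fun k r hr => ?_⟩
      rw [Function.iterate_succ_apply', hq.derivSeq_eq]
      simp only [Letter.len]
      rw [(h.desub n).apply k r hr, sub, Letter.long_mk]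
  choose q hq using hc
  refine ⟨x, ⟨⟨fun i => ?_, fun n => (hq n).isDifferentiable⟩, fun n => ?_⟩, hc0.recode_eq⟩
  · obtain ⟨k, r, hr, rfl⟩ := hc0.part.cover i
    rw [hx k r hr]
    cases (z 0 k).sym <;> simp [val]
  · rw [(hq n).recode_eq]
    exact h.isOfType n

/-! ### From smooth sequences to towers -/

/-- A coding of the sequence of lengths of an alternating sequence is a desubstitution. -/
theorem IsCoding.exists_desub {y z : ℤ → Letter} {p : ℤ → ℤ} (hy : Alternating y)
    (h : IsCoding (fun k => (y k).len) z p) : ∃ t, IsDesub t y z p := by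
  have hlong : ∀ k, ∀ r < (z k).len, (y (p k + (r : ℕ))).long = (z k).sym := fun k r hr =>
    val_injective (h.apply k r hr)
  -- Blocks have odd length, so passing to the next block flips both the first symbol of the group
  -- and the symbol of the coding letter; their parity is therefore the same for all `k`, and it
  -- defines `t`.
  have hstep : ∀ k, ((y (p (k + 1))).sym ^^ (z (k + 1)).sym) = ((y (p k)).sym ^^ (z k).sym) := by
    intro k
    have hodd : (z k).len % 2 = 1 := by
      rw [Letter.len]; cases (z k).long <;> simp [val]
    rw [h.part.step, hy.sym_add, h.alt, hodd]
    cases (y (p k)).sym <;> cases (z k).sym <;> rfl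
  have hconst : ∀ k, ((y (p k)).sym ^^ (z k).sym) = ((y (p 0)).sym ^^ (z 0).sym) := by
    intro k
    induction k using Int.induction_on with
    | zero => rfl
    | succ i ih => rw [hstep, ih]
    | pred i ih =>
      rw [← ih, ← hstep, sub_add_cancel]
  refine ⟨if ((y (p 0)).sym ^^ (z 0).sym) then 1 else 0, h.part, fun k r hr => ?_⟩
  refine Letter.eq_of ?_ ?_
  · rw [hy.sym_add, sub, Letter.sym_mk, ← hconst k]
    cases (y (p k)).sym <;> cases (z k).sym <;> simp
  · rw [hlong k r hr, sub, Letter.long_mk]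

/-- From an interior position of a block, the next block is at most two steps away since blocks have
length at most `3`, and the symbol changes there. -/
theorem IsCoding.start_of_triple {x : ℤ → ℕ} {z : ℤ → Letter} {p : ℤ → ℤ} (h : IsCoding x z p)
    {i : ℤ} (h1 : x (i + 1) = x i) (h2 : x (i + 2) = x i) : ∃ k, i = p k := by
  obtain ⟨k, r, hr, rfl⟩ := h.part.cover i
  have hle := (z k).len_le
  have hx : x (p (k + 1)) ≠ x (p k + r) := by
    rw [h.apply k r hr, h.apply_start, h.alt]
    exact fun he => by simpa using val_injective he
  rw [h.part.step k] at hx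
  rcases Nat.eq_zero_or_pos r with rfl | hr0
  · exact ⟨k, by simp⟩
  · exfalso
    have : (z k).len = r + 1 ∨ (z k).len = r + 2 := by omega
    rcases this with h3 | h3 <;> rw [h3] at hx <;> push_cast at hx
    · exact hx (by rw [← h1]; congr 1; ring)
    · exact hx (by rw [← h2]; congr 1; ring)

/-- An elementary block consists of three letters of equal length, so it starts at the beginning of
an image. The first letter of any image reveals `t` through the parity of its symbol and its length.
-/
theorem IsDesub.eq_of_isOfType {t s : Fin 2} {y z : ℤ → Letter} {p : ℤ → ℤ}
    (h : IsDesub t y z p) (hc : IsCoding (fun k => (y k).len) z p) (hs : IsOfType y s) :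
    t = s := by
  have key : ∀ i, ∀ a b, OccursAt [a, b, a] y i → a.len = b.len →
      (a.sym ^^ a.long) = decide (t = 1) := by
    intro i a b hi hab
    rw [occursAt_triple] at hi
    obtain ⟨h0, h1, h2⟩ := hi
    obtain ⟨k, rfl⟩ := hc.start_of_triple (i := i) (by simp only [h0, h1, hab])
      (by simp only [h0, h2])
    have h3 := h.apply k 0 (Letter.len_pos _)
    simp only [Nat.cast_zero, add_zero, h0] at h3
    rw [h3, sub, Letter.sym_mk, Letter.long_mk]
    cases (z k).sym <;> simp
  have ht : t = 0 ∨ t = 1 := by omega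
  have hs' : s = 0 ∨ s = 1 := by omega
  rcases hs' with rfl | rfl
  · simp only [IsOfType, if_pos] at hs
    rcases hs with ⟨i, hi⟩ | ⟨i, hi⟩ <;>
    · have := key i _ _ hi rfl
      rcases ht with rfl | rfl
      · rfl
      · simp [Letter.sym, Letter.long] at this
  · simp only [IsOfType, one_ne_zero, if_false] at hs
    rcases hs with ⟨i, hi⟩ | ⟨i, hi⟩ <;>
    · have := key i _ _ hi rfl
      rcases ht with rfl | rfl
      · simp [Letter.sym, Letter.long] at this
      · rfl

theorem exists_tower {τ : ℕ → Fin 2} {y : ℤ → Letter} (hy : y ∈ recodedSet τ) :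
    ∃ z p, IsTower τ z p ∧ z 0 = y := by
  obtain ⟨x, ⟨⟨hx, hd⟩, ht⟩, rfl⟩ := hy
  have h13 : ∀ n, Over13 (derivSeq^[n] x) := by
    intro n
    cases n with
    | zero => exact hx
    | succ n => rw [Function.iterate_succ_apply']; exact (hd n).2
  have hc := fun n => (hd n).isCoding (h13 n)
  refine ⟨fun n => recode (derivSeq^[n] x), fun n => blockStart (derivSeq^[n + 1] x),
    ⟨fun n => (hc n).alt, fun n => ?_⟩, rfl⟩
  have h1 := hc (n + 1)
  rw [Function.iterate_succ_apply'] at h1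
  have h2 := h1
  rw [(hc n).derivSeq_eq] at h2
  obtain ⟨t, h3⟩ := h2.exists_desub (hc n).alt
  have h4 := h3.eq_of_isOfType h2 (ht n)
  rw [h4, ← (hc n).derivSeq_eq] at h3
  rwa [Function.iterate_succ_apply']

/-- No normalization of the starting points is required here, since renumbering the levels restores
it without changing `z 0`. -/
theorem mem_recodedSet_iff {τ : ℕ → Fin 2} {y : ℤ → Letter} :
    y ∈ recodedSet τ ↔ ∃ z p, IsTower τ z p ∧ z 0 = y := by
  refine ⟨exists_tower, ?_⟩
  rintro ⟨z, p, h, rfl⟩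
  obtain ⟨z', p', h', h0, hn⟩ := h.exists_normalized 0
  have := h'.mem_recodedSet hn
  simpa [h0] using this

theorem shift_mem_recodedSet {τ : ℕ → Fin 2} {y : ℤ → Letter} (hy : y ∈ recodedSet τ) (i : ℤ) :
    (fun l => y (l + i)) ∈ recodedSet τ := by
  obtain ⟨z, p, h, rfl⟩ := exists_tower hy
  obtain ⟨z', p', h', h0, hn⟩ := h.exists_normalized i
  exact h0 ▸ h'.mem_recodedSet hn

/-! ### Translation invariant densities on `ℤ` -/

/-- A finitely additive, translation invariant probability on the subsets of `ℤ`. -/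
structure IsDensity (d : Set ℤ → ℝ) : Prop where
  nonneg : ∀ E, 0 ≤ d E
  union : ∀ E F, Disjoint E F → d (E ∪ F) = d E + d F
  univ : d Set.univ = 1
  translate_one : ∀ E, d ((fun i => i + 1) '' E) = d E

/-- The translate of a set of integers. -/
def translate (E : Set ℤ) (c : ℕ) : Set ℤ := (fun i => i + (c : ℤ)) '' E

theorem IsDensity.translate {d : Set ℤ → ℝ} (h : IsDensity d) (E : Set ℤ) (c : ℕ) :
    d (translate E c) = d E := by
  induction c with
  | zero => simp [SmoothSeq.translate]
  | succ c ih =>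
    rw [← ih, ← h.translate_one (SmoothSeq.translate E c)]
    simp only [SmoothSeq.translate, Set.image_image]
    congr 2
    funext i
    push_cast; ring

theorem IsDensity.empty {d : Set ℤ → ℝ} (h : IsDensity d) : d ∅ = 0 := by
  have := h.union ∅ ∅ (by simp)
  simp at this
  exact this

theorem IsDensity.mono {d : Set ℤ → ℝ} (h : IsDensity d) {E F : Set ℤ} (hEF : E ⊆ F) :
    d E ≤ d F := by
  have := h.union E (F \ E) Set.disjoint_sdiff_right
  rw [Set.union_sdiff_cancel hEF] at this
  linarith [h.nonneg (F \ E)]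

theorem IsDensity.union_le {d : Set ℤ → ℝ} (h : IsDensity d) (E F : Set ℤ) :
    d (E ∪ F) ≤ d E + d F := by
  have := h.union E (F \ E) Set.disjoint_sdiff_right
  rw [Set.union_sdiff_self] at this
  linarith [h.mono (E := F \ E) Set.sdiff_subset]

theorem IsDensity.biUnion {d : Set ℤ → ℝ} (h : IsDensity d) {ι : Type*} (s : Finset ι)
    (F : ι → Set ℤ) (hF : ∀ i ∈ s, ∀ j ∈ s, i ≠ j → Disjoint (F i) (F j)) :
    d (⋃ i ∈ s, F i) = ∑ i ∈ s, d (F i) := by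
  classical
  induction s using Finset.induction_on with
  | empty => simp [h.empty]
  | insert a s ha ih =>
    rw [Finset.set_biUnion_insert, Finset.sum_insert ha, h.union, ih]
    · exact fun i hi j hj => hF i (Finset.mem_insert_of_mem hi) j (Finset.mem_insert_of_mem hj)
    · rw [Set.disjoint_iUnion₂_right]
      exact fun i hi => hF a (Finset.mem_insert_self _ _) i (Finset.mem_insert_of_mem hi)
        (by rintro rfl; exact ha hi)

theorem IsDensity.biUnion_le {d : Set ℤ → ℝ} (h : IsDensity d) {ι : Type*} (s : Finset ι)
    (F : ι → Set ℤ) : d (⋃ i ∈ s, F i) ≤ ∑ i ∈ s, d (F i) := by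
  classical
  induction s using Finset.induction_on with
  | empty => simp [h.empty]
  | insert a s ha ih =>
    rw [Finset.set_biUnion_insert, Finset.sum_insert ha]
    exact (h.union_le _ _).trans (by gcongr)

/-- The proportion of the elements of `E` in `{1, …, n}`. -/
noncomputable def average (E : Set ℤ) (n : ℕ) : ℝ :=
  (∑ j ∈ Finset.range n, E.indicator (1 : ℤ → ℝ) ((j : ℤ) + 1)) / n

theorem average_mem (E : Set ℤ) (n : ℕ) : average E n ∈ Set.Icc (0 : ℝ) 1 := by
  have h1 : ∀ i, 0 ≤ E.indicator (1 : ℤ → ℝ) i ∧ E.indicator (1 : ℤ → ℝ) i ≤ 1 := by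
    intro i
    by_cases hi : i ∈ E <;> simp [hi]
  constructor
  · exact div_nonneg (Finset.sum_nonneg fun i _ => (h1 _).1) (Nat.cast_nonneg _)
  · refine div_le_one_of_le₀ ?_ (Nat.cast_nonneg _)
    calc _ ≤ ∑ j ∈ Finset.range n, (1 : ℝ) := Finset.sum_le_sum fun i _ => (h1 _).2
      _ = n := by simp

theorem average_union {E F : Set ℤ} (h : Disjoint E F) (n : ℕ) :
    average (E ∪ F) n = average E n + average F n := by
  simp only [average, ← add_div, ← Finset.sum_add_distrib]
  rw [Set.indicator_union_of_disjoint h]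

/-- The difference of the two sums telescopes to two boundary terms. -/
theorem abs_average_translate_sub_le (E : Set ℤ) (n : ℕ) :
    |average ((fun i => i + 1) '' E) n - average E n| ≤ 1 / n := by
  have h1 : ∀ i : ℤ, ((fun i => i + 1) '' E).indicator (1 : ℤ → ℝ) (i + 1) =
      E.indicator (1 : ℤ → ℝ) i := by
    intro i
    by_cases hi : i ∈ E <;> simp [hi, Set.indicator]
  have h2 : ∑ j ∈ Finset.range n, E.indicator (1 : ℤ → ℝ) ((j : ℤ) + 1) -
      ∑ j ∈ Finset.range n, E.indicator (1 : ℤ → ℝ) (j : ℤ) =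
      E.indicator (1 : ℤ → ℝ) (n : ℤ) - E.indicator (1 : ℤ → ℝ) 0 := by
    rw [← Finset.sum_sub_distrib]
    have := Finset.sum_range_sub (fun j : ℕ => E.indicator (1 : ℤ → ℝ) (j : ℤ)) n
    push_cast at this
    exact this
  have h3 : |E.indicator (1 : ℤ → ℝ) (n : ℤ) - E.indicator (1 : ℤ → ℝ) 0| ≤ 1 := by
    by_cases hn : (n : ℤ) ∈ E <;> by_cases h0 : (0 : ℤ) ∈ E <;> simp [hn, h0]
  simp only [average, h1, ← sub_div]
  rw [abs_div, Nat.abs_cast, abs_sub_comm, h2]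
  gcongr

/-- Along an ultrafilter the averages of every set converge at once, by compactness of `[0, 1]`. The
limits are translation invariant because a translation costs only `1 / n`. -/
theorem exists_isDensity_tendsto (U : Ultrafilter ℕ) (hU : (U : Filter ℕ) ≤ atTop) :
    ∃ d, IsDensity d ∧ ∀ E, Tendsto (average E) U (𝓝 (d E)) := by
  have h : ∀ E, ∃ l ∈ Set.Icc (0 : ℝ) 1, Tendsto (average E) U (𝓝 l) := fun E =>
    (isCompact_Icc (a := (0 : ℝ)) (b := 1)).ultrafilter_le_nhds (U.map (average E))
      (le_principal_iff.2 (Eventually.of_forall (average_mem E) : ∀ᶠ n in (U : Filter ℕ), _))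
  choose d hd hlim using h
  refine ⟨d, ⟨fun E => (hd E).1, fun E F hEF => ?_, ?_, fun E => ?_⟩, hlim⟩
  · refine tendsto_nhds_unique (hlim _) (((hlim E).add (hlim F)).congr fun n => ?_)
    rw [average_union hEF]
  · refine tendsto_nhds_unique (hlim _) (tendsto_const_nhds.congr' ?_)
    filter_upwards [hU (eventually_gt_atTop 0)] with n hn
    have : (n : ℝ) ≠ 0 := by positivity
    simp [average, this]
  · have h0 : Tendsto (fun n => average ((fun i => i + 1) '' E) n - average E n) U (𝓝 0) :=
      squeeze_zero_norm (abs_average_translate_sub_le E)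
        (tendsto_one_div_atTop_nhds_zero_nat.mono_left hU)
    have := tendsto_nhds_unique h0 ((hlim _).sub (hlim E))
    linarith

theorem tendsto_average {E : Set ℤ} {v : ℝ} (h : ∀ d, IsDensity d → d E = v) :
    Tendsto (average E) atTop (𝓝 v) := by
  rw [tendsto_iff_ultrafilter]
  intro U hU
  obtain ⟨d, hd, hlim⟩ := exists_isDensity_tendsto U hU
  exact h d hd ▸ hlim E

/-! ### The frequencies of the letters at each level -/

/-- Sequences of positive vectors that satisfy the recurrence relations of the frequencies of the
letters: `c m` and `q m` stand for the frequencies of `C` and `D` at the level `m`, and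
`s m` for those of `{A, C}` and of `{B, D}`. -/
structure IsFreq (τ : ℕ → Fin 2) (s c q : ℕ → ℝ) : Prop where
  zero : s 0 = 1 / 2
  c_nonneg : ∀ m, 0 ≤ c m
  c_le : ∀ m, c m ≤ s m
  q_nonneg : ∀ m, 0 ≤ q m
  q_le : ∀ m, q m ≤ s m
  s_eq : ∀ m, s m = s (m + 1) + c (m + 1) + q (m + 1)
  of_zero : ∀ m, τ m = 0 → c m = q (m + 1) ∧ q m = s (m + 1) + q (m + 1)
  of_one : ∀ m, τ m = 1 → c m = s (m + 1) + q (m + 1) ∧ q m = q (m + 1)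

theorem IsFreq.pos {τ : ℕ → Fin 2} {s c q : ℕ → ℝ} (h : IsFreq τ s c q) (m : ℕ) : 0 < s m := by
  induction m with
  | zero => rw [h.zero]; norm_num
  | succ m ih => linarith [h.s_eq m, h.c_le (m + 1), h.q_le (m + 1)]

theorem IsFreq.cases {τ : ℕ → Fin 2} {s c q : ℕ → ℝ} (h : IsFreq τ s c q) (m : ℕ) :
    (τ m = 0 ∧ c m = q (m + 1) ∧ q m = s (m + 1) + q (m + 1)) ∨
      (τ m = 1 ∧ c m = s (m + 1) + q (m + 1) ∧ q m = q (m + 1)) := by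
  have : τ m = 0 ∨ τ m = 1 := by omega
  rcases this with h0 | h0
  · exact .inl ⟨h0, h.of_zero m h0⟩
  · exact .inr ⟨h0, h.of_one m h0⟩

/-- In both cases of the recurrence `c m + q m` equals `s (m + 1) + 2 * q (m + 1)`, whereas `s m ≤ 2
* s (m + 1) + q (m + 1)`. This lower bound, uniform in `τ`, is what makes the ratios contract. -/
theorem IsFreq.half_le {τ : ℕ → Fin 2} {s c q : ℕ → ℝ} (h : IsFreq τ s c q) (m : ℕ) :
    s m / 2 ≤ c m + q m := by
  have h1 := h.s_eq m
  have h2 := h.c_le (m + 1)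
  have h3 := h.q_nonneg (m + 1)
  rcases h.cases m with ⟨_, h4, h5⟩ | ⟨_, h4, h5⟩ <;> linarith

theorem IsFreq.le_pow {τ : ℕ → Fin 2} {s c q : ℕ → ℝ} (h : IsFreq τ s c q) (m : ℕ) :
    s m ≤ (2 / 3) ^ m := by
  induction m with
  | zero => rw [h.zero]; norm_num
  | succ m ih =>
    rw [pow_succ]
    linarith [h.s_eq m, h.half_le (m + 1)]

theorem IsFreq.tendsto {τ : ℕ → Fin 2} {s c q : ℕ → ℝ} (h : IsFreq τ s c q) :
    Tendsto s atTop (𝓝 0) :=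
  squeeze_zero (fun m => (h.pos m).le) h.le_pow
    (tendsto_pow_atTop_nhds_zero_of_lt_one (by norm_num) (by norm_num))

/-- The factor `2 / 3` is the inverse of the lower bound `3 / 2` for `1 + p + q`. -/
theorem abs_div_sub_div_le {p q p' q' δ u u' : ℝ} (hp : 0 ≤ p') (hq : 0 ≤ q')
    (hpq : 1 / 2 ≤ p + q)
    (hu : |u * (1 + p' + q') - (1 + p + q) * u'| ≤ δ * (1 + p' + q')) :
    |u / (1 + p + q) - u' / (1 + p' + q')| ≤ 2 / 3 * δ := by
  have h1 : 0 < 1 + p + q := by linarith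
  have h2 : 0 < 1 + p' + q' := by linarith
  have hδ : 0 ≤ δ := by
    have := (abs_nonneg _).trans hu
    exact nonneg_of_mul_nonneg_left this h2
  rw [div_sub_div _ _ h1.ne' h2.ne', abs_div, abs_of_pos (mul_pos h1 h2),
    div_le_iff₀ (mul_pos h1 h2)]
  refine hu.trans ?_
  nlinarith [mul_nonneg hδ h2.le, mul_nonneg (mul_nonneg hδ h2.le) (sub_nonneg.2 hpq)]

/-- The cross differences are `(q - q') * (1 + p') - (p - p') * q'` and `(q - q') * p' - (p - p') *
(1 + q')`; in both, the coefficients have absolute values summing to `1 + p' + q'`. -/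
theorem abs_sub_le_of_projective_step {p q p' q' δ : ℝ} (hp : 0 ≤ p') (hq : 0 ≤ q')
    (hpq : 1 / 2 ≤ p + q) (h1 : |p - p'| ≤ δ) (h2 : |q - q'| ≤ δ) :
    |q / (1 + p + q) - q' / (1 + p' + q')| ≤ 2 / 3 * δ ∧
      |(1 + q) / (1 + p + q) - (1 + q') / (1 + p' + q')| ≤ 2 / 3 * δ := by
  rw [abs_le] at h1 h2
  have a1 : (0 : ℝ) ≤ 1 + p' := by linarith
  have a2 : (0 : ℝ) ≤ 1 + q' := by linarith
  constructor
  · refine abs_div_sub_div_le hp hq hpq (abs_le.2 ⟨?_, ?_⟩)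
    · nlinarith [mul_le_mul_of_nonneg_left h2.1 a1, mul_le_mul_of_nonneg_left h1.2 hq]
    · nlinarith [mul_le_mul_of_nonneg_left h2.2 a1, mul_le_mul_of_nonneg_left h1.1 hq]
  · refine abs_div_sub_div_le hp hq hpq (abs_le.2 ⟨?_, ?_⟩)
    · nlinarith [mul_le_mul_of_nonneg_left h2.1 hp, mul_le_mul_of_nonneg_left h1.2 a2]
    · nlinarith [mul_le_mul_of_nonneg_left h2.2 hp, mul_le_mul_of_nonneg_left h1.1 a2]

/-- Dividing the recurrence by `s m` turns it into the two projective maps above; the value of `τ m`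
only decides which of the two gives `c` and which gives `q`. -/
theorem IsFreq.ratio_step {τ : ℕ → Fin 2} {s c q s' c' q' : ℕ → ℝ} (h : IsFreq τ s c q)
    (h' : IsFreq τ s' c' q') {m : ℕ} {δ : ℝ}
    (h1 : |c (m + 1) / s (m + 1) - c' (m + 1) / s' (m + 1)| ≤ δ)
    (h2 : |q (m + 1) / s (m + 1) - q' (m + 1) / s' (m + 1)| ≤ δ) :
    |c m / s m - c' m / s' m| ≤ 2 / 3 * δ ∧ |q m / s m - q' m / s' m| ≤ 2 / 3 * δ := by
  have e : ∀ {s c q : ℕ → ℝ}, IsFreq τ s c q →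
      q (m + 1) / s m = q (m + 1) / s (m + 1) / (1 + c (m + 1) / s (m + 1) + q (m + 1) / s (m + 1)) ∧
      (s (m + 1) + q (m + 1)) / s m = (1 + q (m + 1) / s (m + 1)) /
        (1 + c (m + 1) / s (m + 1) + q (m + 1) / s (m + 1)) := by
    intro s c q h
    have hs := h.pos m
    have hs' := (h.pos (m + 1)).ne'
    rw [h.s_eq m] at hs ⊢
    have hs0 := hs.ne'
    have : 1 + c (m + 1) / s (m + 1) + q (m + 1) / s (m + 1) =
        (s (m + 1) + c (m + 1) + q (m + 1)) / s (m + 1) := by field_simp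
    rw [this]
    constructor <;> field_simp
  have key := abs_sub_le_of_projective_step
    (div_nonneg (h'.c_nonneg (m + 1)) (h'.pos (m + 1)).le)
    (div_nonneg (h'.q_nonneg (m + 1)) (h'.pos (m + 1)).le)
    (by rw [← add_div, le_div_iff₀ (h.pos _)]; linarith [h.half_le (m + 1)]) h1 h2
  rw [← (e h).1, ← (e h').1, ← (e h).2, ← (e h').2] at key
  rcases h.cases m with ⟨h0, h3, h4⟩ | ⟨h0, h3, h4⟩
  · obtain ⟨h5, h6⟩ := h'.of_zero m h0
    rw [h3, h4, h5, h6]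
    exact key
  · obtain ⟨h5, h6⟩ := h'.of_one m h0
    rw [h3, h4, h5, h6]
    exact key.symm

theorem IsFreq.ratio_eq {τ : ℕ → Fin 2} {s c q s' c' q' : ℕ → ℝ} (h : IsFreq τ s c q)
    (h' : IsFreq τ s' c' q') (m : ℕ) : c m / s m = c' m / s' m ∧ q m / s m = q' m / s' m := by
  have unit : ∀ {a b : ℝ}, 0 ≤ a → a ≤ b → a / b ∈ Set.Icc (0 : ℝ) 1 := fun ha hab =>
    ⟨div_nonneg ha (ha.trans hab), div_le_one_of_le₀ hab (ha.trans hab)⟩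
  -- Both pairs of ratios lie in `[0, 1]` at level `m + n`; descending `n` levels contracts their
  -- distance `n` times.
  have bound : ∀ n m, |c m / s m - c' m / s' m| ≤ (2 / 3) ^ n ∧
      |q m / s m - q' m / s' m| ≤ (2 / 3) ^ n := by
    intro n
    induction n with
    | zero =>
      intro m
      have h1 := unit (h.c_nonneg m) (h.c_le m)
      have h2 := unit (h'.c_nonneg m) (h'.c_le m)
      have h3 := unit (h.q_nonneg m) (h.q_le m)
      have h4 := unit (h'.q_nonneg m) (h'.q_le m)
      simp only [Set.mem_Icc] at h1 h2 h3 h4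
      constructor <;> rw [abs_le] <;> constructor <;> linarith
    | succ n ih =>
      intro m
      rw [pow_succ']
      exact h.ratio_step h' (ih (m + 1)).1 (ih (m + 1)).2
  have lim : Tendsto (fun n : ℕ => (2 / 3 : ℝ) ^ n) atTop (𝓝 0) :=
    tendsto_pow_atTop_nhds_zero_of_lt_one (by norm_num) (by norm_num)
  constructor
  · exact sub_eq_zero.1 (abs_nonpos_iff.1 (ge_of_tendsto' lim fun n => (bound n m).1))
  · exact sub_eq_zero.1 (abs_nonpos_iff.1 (ge_of_tendsto' lim fun n => (bound n m).2))

/-- The ratios determine the factor from `s (m + 1)` to `s m`, so the common value `s 0 = 1 / 2`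
propagates upwards. -/
theorem IsFreq.eq {τ : ℕ → Fin 2} {s c q s' c' q' : ℕ → ℝ} (h : IsFreq τ s c q)
    (h' : IsFreq τ s' c' q') (m : ℕ) : s m = s' m ∧ c m = c' m ∧ q m = q' m := by
  have hs : s m = s' m := by
    induction m with
    | zero => rw [h.zero, h'.zero]
    | succ m ih =>
      have e : ∀ {s c q : ℕ → ℝ}, IsFreq τ s c q →
          s m = s (m + 1) * (1 + c (m + 1) / s (m + 1) + q (m + 1) / s (m + 1)) := by
        intro s c q h
        have := (h.pos (m + 1)).ne'
        rw [h.s_eq m]; field_simp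
      obtain ⟨h1, h2⟩ := h.ratio_eq h' (m + 1)
      rw [e h, e h', h1, h2] at ih
      refine mul_right_cancel₀ (ne_of_gt ?_) ih
      have h3 := div_nonneg (h'.c_nonneg (m + 1)) (h'.pos (m + 1)).le
      have h4 := div_nonneg (h'.q_nonneg (m + 1)) (h'.pos (m + 1)).le
      linarith
  obtain ⟨h1, h2⟩ := h.ratio_eq h' m
  have := h'.pos m
  rw [hs] at h1 h2
  exact ⟨hs, (div_left_inj' this.ne').1 h1, (div_left_inj' this.ne').1 h2⟩

/-! ### The blocks of higher level -/

/-- The starting points, in `z 0`, of the blocks of level `m`. -/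
def pos (p : ℕ → ℤ → ℤ) : ℕ → ℤ → ℤ
  | 0 => id
  | m + 1 => fun k => pos p m (p m k)

/-- The word of `z 0` that is coded by the letter `b` of `z m`. -/
def word (τ : ℕ → Fin 2) : ℕ → Letter → List Letter
  | 0, b => [b]
  | m + 1, b =>
    if b.long then
      word τ m (sub (τ m) b 0) ++ (word τ m (sub (τ m) b 1) ++ word τ m (sub (τ m) b 2))
    else word τ m (sub (τ m) b 0)

/-- The starting points, in `z 0`, of the blocks of level `m` coded by `a`. -/
def blockSet (z : ℕ → ℤ → Letter) (p : ℕ → ℤ → ℤ) (m : ℕ) (a : Letter) : Set ℤ :=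
  pos p m '' {k | z m k = a}

theorem word_length_pos (τ : ℕ → Fin 2) (m : ℕ) (b : Letter) : 0 < (word τ m b).length := by
  induction m generalizing b with
  | zero => simp [word]
  | succ m ih =>
    rw [word]
    split_ifs
    · rw [List.length_append]
      exact Nat.add_pos_left (ih _) _
    · exact ih _

theorem occursAt_iff {w : List Letter} {y : ℤ → Letter} {i : ℤ} :
    OccursAt w y i ↔ ∀ k (hk : k < w.length), y (i + (k : ℕ)) = w[k] := by
  simp only [OccursAt, Fin.forall_iff, List.get_eq_getElem]

theorem OccursAt.append {u v : List Letter} {y : ℤ → Letter} {i : ℤ} (hu : OccursAt u y i)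
    (hv : OccursAt v y (i + u.length)) : OccursAt (u ++ v) y i := by
  rw [occursAt_iff] at *
  intro k hk
  rw [List.getElem_append]
  split_ifs with h
  · exact hu k h
  · rw [← hv (k - u.length) (by rw [List.length_append] at hk; omega)]
    congr 1
    omega

section Tower

variable {τ : ℕ → Fin 2} {z : ℕ → ℤ → Letter} {p : ℕ → ℤ → ℤ}

theorem IsTower.isPartition_pos (h : IsTower τ z p) (m : ℕ) :
    IsPartition (pos p m) (fun k => (word τ m (z m k)).length) := by
  refine ⟨fun k => word_length_pos _ _ _, ?_⟩
  induction m with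
  | zero => intro k; simp [pos, word]
  | succ m ih =>
    intro k
    have h0 := (h.desub m).apply k 0
    have h1 := (h.desub m).apply k 1
    have h2 := (h.desub m).apply k 2
    simp only [Nat.cast_zero, add_zero, Nat.cast_one, Nat.cast_ofNat] at h0 h1 h2
    simp only [pos]
    rw [(h.desub m).part.step k, word]
    cases hl : (z (m + 1) k).long
    · have hlen : (z (m + 1) k).len = 1 := by simp [Letter.len, hl, val]
      rw [hlen] at h0 ⊢
      rw [Nat.cast_one, ih, h0 (by omega)]
      simp
    · have hlen : (z (m + 1) k).len = 3 := by simp [Letter.len, hl, val]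
      rw [hlen] at h0 h1 h2 ⊢
      rw [show p m k + ((3 : ℕ) : ℤ) = p m k + 1 + 1 + 1 by push_cast; ring, ih, ih, ih,
        show p m k + 1 + 1 = p m k + 2 by ring, h0 (by omega), h1 (by omega), h2 (by omega)]
      simp
      ring

theorem IsTower.occursAt_word (h : IsTower τ z p) (m : ℕ) (k : ℤ) :
    OccursAt (word τ m (z m k)) (z 0) (pos p m k) := by
  induction m generalizing k with
  | zero =>
    rw [occursAt_iff]
    intro i hi
    simp [word] at hi
    subst hi
    simp [pos, word]
  | succ m ih =>
    have h0 := (h.desub m).apply k 0 (Letter.len_pos _)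
    have h1 := (h.desub m).apply k 1
    have h2 := (h.desub m).apply k 2
    simp only [Nat.cast_zero, add_zero, Nat.cast_one, Nat.cast_ofNat] at h0 h1 h2
    simp only [pos]
    rw [word]
    split_ifs with hl
    · have hlen : (z (m + 1) k).len = 3 := by simp [Letter.len, hl, val]
      rw [hlen] at h1 h2
      have i0 := ih (p m k)
      have i1 := ih (p m k + 1)
      have i2 := ih (p m k + 1 + 1)
      have e2 := (h.isPartition_pos m).step (p m k + 1)
      have e1 := (h.isPartition_pos m).step (p m k)
      rw [e2] at i2
      rw [e1] at i1 i2
      rw [show p m k + 1 + 1 = p m k + 2 by ring, h2 (by omega)] at i2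
      rw [h1 (by omega)] at i1 i2
      rw [h0] at i0 i1 i2
      exact i0.append (i1.append i2)
    · rw [← h0]
      exact ih _

theorem IsTower.pos_mem_blockSet (h : IsTower τ z p) {m : ℕ} {k : ℤ} {a : Letter} :
    pos p m k ∈ blockSet z p m a ↔ z m k = a := by
  constructor
  · rintro ⟨l, hl, he⟩
    rw [← (h.isPartition_pos m).strictMono.injective he]
    exact hl
  · exact fun hk => ⟨k, hk, rfl⟩

theorem IsTower.disjoint_translate (h : IsTower τ z p) {m : ℕ} {a b : Letter} {r s : ℕ}
    (hr : r < (word τ m a).length) (hs : s < (word τ m b).length) (hne : (a, r) ≠ (b, s)) :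
    Disjoint (translate (blockSet z p m a) r) (translate (blockSet z p m b) s) := by
  rw [Set.disjoint_left]
  rintro _ ⟨_, ⟨k, hk, rfl⟩, rfl⟩ ⟨_, ⟨l, hl, rfl⟩, he⟩
  simp only [Set.mem_ofPred_eq] at hk hl
  obtain ⟨rfl, rfl⟩ := (h.isPartition_pos m).unique (k := l) (l := k) (by rwa [hl]) (by rwa [hk]) he
  exact hne (by rw [← hk, ← hl])

theorem IsTower.disjoint_blockSet (h : IsTower τ z p) {m : ℕ} {a b : Letter} (hne : a ≠ b) :
    Disjoint (blockSet z p m a) (blockSet z p m b) := by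
  have := h.disjoint_translate (m := m) (word_length_pos _ _ a) (word_length_pos _ _ b)
    (by simpa using hne)
  simpa [translate] using this

/-! ### Densities of the blocks at consecutive levels -/

/-- The blocks alternate between `{A, C}` and `{B, D}`. -/
theorem IsTower.density_balance (h : IsTower τ z p) {d : Set ℤ → ℝ} (hd : IsDensity d) (m : ℕ) :
    d (blockSet z p m .A) + d (blockSet z p m .C) =
      d (blockSet z p m .B) + d (blockSet z p m .D) := by
  have hP := h.isPartition_pos m
  -- Translating the start of a block by its own length gives the start of the next block, whose
  -- symbol is the opposite one.
  have hset : translate (blockSet z p m .A) (word τ m .A).length ∪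
      translate (blockSet z p m .C) (word τ m .C).length =
      blockSet z p m .B ∪ blockSet z p m .D := by
    ext i
    constructor
    · rintro (⟨_, ⟨k, hk, rfl⟩, rfl⟩ | ⟨_, ⟨k, hk, rfl⟩, rfl⟩) <;>
      · simp only [Set.mem_ofPred_eq] at hk
        have h1 := hP.step k
        have h2 := h.alt m k
        simp only [hk] at h1 h2 ⊢
        rw [← h1, Set.mem_union, h.pos_mem_blockSet, h.pos_mem_blockSet]
        cases hz : z m (k + 1) <;> simp_all [Letter.sym]
    · rintro (⟨k, hk, rfl⟩ | ⟨k, hk, rfl⟩) <;>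
      · simp only [Set.mem_ofPred_eq] at hk
        have h1 := hP.step (k - 1)
        have h2 := h.alt m (k - 1)
        rw [sub_add_cancel] at h1 h2
        rw [hk] at h2
        cases hz : z m (k - 1) <;> simp only [hz, Letter.sym] at h1 h2 <;> simp at h2
        · exact .inl ⟨_, ⟨k - 1, hz, rfl⟩, h1.symm⟩
        · exact .inr ⟨_, ⟨k - 1, hz, rfl⟩, h1.symm⟩
  rw [← hd.translate (blockSet z p m .A) (word τ m .A).length,
    ← hd.translate (blockSet z p m .C) (word τ m .C).length,
    ← hd.union, ← hd.union, hset]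
  · exact h.disjoint_blockSet (by simp)
  · rw [Set.disjoint_left]
    rintro _ ⟨_, ⟨k, hk, rfl⟩, rfl⟩ ⟨_, ⟨l, hl, rfl⟩, he⟩
    simp only [Set.mem_ofPred_eq] at hk hl he
    have h1 := hP.step k
    have h2 := hP.step l
    simp only [hk, hl] at h1 h2
    rw [← h1, ← h2] at he
    have := hP.strictMono.injective he
    rw [add_left_inj] at this
    rw [this, hk] at hl
    simp at hl

/-- A letter whose symbol is not the one with which the images of the letters begin only occurs in
the middle of the image of a long letter. -/
theorem IsTower.density_middle (h : IsTower τ z p) {d : Set ℤ → ℝ} (hd : IsDensity d) (m : ℕ)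
    (l : Bool) : d (blockSet z p m (.mk (!(l ^^ decide (τ m = 1))) l)) =
      d (blockSet z p (m + 1) (.mk l true)) := by
  have hP := h.isPartition_pos m
  -- This translation moves the start of the image of a long letter to its middle word.
  rw [← hd.translate (blockSet z p (m + 1) (.mk l true))
    (word τ m (.mk (l ^^ decide (τ m = 1)) l)).length]
  congr 1
  have hnext : ∀ j, (z (m + 1) j).sym = l →
      pos p m (p m j + 1) = pos p m (p m j) + (word τ m (.mk (l ^^ decide (τ m = 1)) l)).length := by
    intro j hj
    have h0 := (h.desub m).apply j 0 (Letter.len_pos _)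
    simp only [Nat.cast_zero, add_zero] at h0
    rw [hP.step, h0, sub, hj]
    simp
  ext i
  constructor
  · rintro ⟨k, hk, rfl⟩
    obtain ⟨j, r, hr, rfl⟩ := (h.desub m).part.cover k
    simp only [Set.mem_ofPred_eq] at hk
    rw [(h.desub m).apply j r hr, sub] at hk
    have h1 := congrArg Letter.sym hk
    have h2 := congrArg Letter.long hk
    simp only [Letter.sym_mk, Letter.long_mk] at h1 h2
    rw [h2] at h1
    have hodd : r % 2 = 1 := by
      by_contra hc
      simp [hc] at h1
    have hlong : (z (m + 1) j).long = true := by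
      by_contra hc
      have : (z (m + 1) j).len = 1 := by simp [Letter.len, hc, val]
      omega
    have hr1 : r = 1 := by
      have := (z (m + 1) j).len_le
      omega
    subst hr1
    refine ⟨_, ⟨j, ?_, rfl⟩, ?_⟩
    · exact Letter.eq_of (by simp [h2]) (by simp [hlong])
    · simp only [pos, Nat.cast_one]
      rw [hnext j h2]
  · rintro ⟨_, ⟨j, hj, rfl⟩, rfl⟩
    simp only [Set.mem_ofPred_eq] at hj
    refine ⟨p m j + 1, ?_, ?_⟩
    · have h1 := (h.desub m).apply j 1 (by simp [hj, Letter.len, val])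
      simp only [Nat.cast_one] at h1
      simp [h1, hj, sub]
    · rw [hnext j (by simp [hj])]
      rfl

/-- A letter whose symbol is the one with which the images of the letters begin occurs as the image
of a short letter, and at both ends of the image of a long letter. -/
theorem IsTower.density_ends (h : IsTower τ z p) {d : Set ℤ → ℝ} (hd : IsDensity d) (m : ℕ)
    (l : Bool) : d (blockSet z p m (.mk (l ^^ decide (τ m = 1)) l)) =
      d (blockSet z p (m + 1) (.mk l false)) + 2 * d (blockSet z p (m + 1) (.mk l true)) := by
  have hP := h.isPartition_pos m
  -- `c` is the distance from the first to the third word in the image of a long letter.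
  set c := (word τ m (.mk (l ^^ decide (τ m = 1)) l)).length +
    (word τ m (.mk (!(l ^^ decide (τ m = 1))) l)).length with hc
  have hnext : ∀ j, z (m + 1) j = .mk l true →
      pos p m (p m j + 2) = pos p m (p m j) + c := by
    intro j hj
    have hlen : (z (m + 1) j).len = 3 := by simp [Letter.len, hj, val]
    have h0 := (h.desub m).apply j 0 (by omega)
    have h1 := (h.desub m).apply j 1 (by omega)
    simp only [Nat.cast_zero, add_zero, Nat.cast_one] at h0 h1
    rw [show p m j + 2 = p m j + 1 + 1 by ring, hP.step, hP.step, h0, h1, sub, sub, hj, hc]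
    simp
    ring
  have hset : blockSet z p m (.mk (l ^^ decide (τ m = 1)) l) =
      blockSet z p (m + 1) (.mk l false) ∪ (blockSet z p (m + 1) (.mk l true) ∪
        translate (blockSet z p (m + 1) (.mk l true)) c) := by
    ext i
    constructor
    · rintro ⟨k, hk, rfl⟩
      obtain ⟨j, r, hr, rfl⟩ := (h.desub m).part.cover k
      simp only [Set.mem_ofPred_eq] at hk
      rw [(h.desub m).apply j r hr, sub] at hk
      have h1 := congrArg Letter.sym hk
      have h2 := congrArg Letter.long hk
      simp only [Letter.sym_mk, Letter.long_mk] at h1 h2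
      rw [h2] at h1
      have heven : r % 2 = 0 := by
        by_contra hc
        rw [Nat.mod_two_not_eq_zero] at hc
        simp [hc] at h1
      cases hlong : (z (m + 1) j).long
      · have : (z (m + 1) j).len = 1 := by simp [Letter.len, hlong, val]
        have hr0 : r = 0 := by omega
        subst hr0
        exact .inl ⟨j, Letter.eq_of (by simp [h2]) (by simp [hlong]), by simp [pos]⟩
      · have hj : z (m + 1) j = .mk l true := Letter.eq_of (by simp [h2]) (by simp [hlong])
        have hle := (z (m + 1) j).len_le
        have : r = 0 ∨ r = 2 := by omega
        rcases this with rfl | rfl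
        · exact .inr (.inl ⟨j, hj, by simp [pos]⟩)
        · exact .inr (.inr ⟨_, ⟨j, hj, rfl⟩, (hnext j hj).symm⟩)
    · have hstart : ∀ j, (z (m + 1) j).sym = l →
          z m (p m j) = .mk (l ^^ decide (τ m = 1)) l := by
        intro j hj
        have h0 := (h.desub m).apply j 0 (Letter.len_pos _)
        simp only [Nat.cast_zero, add_zero] at h0
        simp [h0, hj, sub]
      rintro (⟨j, hj, rfl⟩ | ⟨j, hj, rfl⟩ | ⟨_, ⟨j, hj, rfl⟩, rfl⟩) <;>
        simp only [Set.mem_ofPred_eq] at hj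
      · exact ⟨p m j, hstart j (by simp [hj]), rfl⟩
      · exact ⟨p m j, hstart j (by simp [hj]), rfl⟩
      · refine ⟨p m j + 2, ?_, hnext j hj⟩
        have h2 := (h.desub m).apply j 2 (by simp [hj, Letter.len, val])
        simp only [Nat.cast_ofNat] at h2
        simp [h2, hj, sub]
  have hdisj : Disjoint (blockSet z p (m + 1) (.mk l true))
      (translate (blockSet z p (m + 1) (.mk l true)) c) := by
    rw [Set.disjoint_left]
    rintro _ ⟨j, hj, rfl⟩ ⟨_, ⟨k, hk, rfl⟩, he⟩
    simp only [Set.mem_ofPred_eq] at hj hk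
    have h1 : pos p m (p m k + 2) = pos p m (p m j) := (hnext k hk).trans he
    have h2 := hP.strictMono.injective h1
    have := (h.desub m).part.unique (k := k) (l := j) (r := 2) (s := 0)
      (by simp [hk, Letter.len, val]) (Letter.len_pos _) (by simpa using h2)
    simp at this
  have hdisj' : Disjoint (blockSet z p (m + 1) (.mk l false))
      (blockSet z p (m + 1) (.mk l true) ∪ translate (blockSet z p (m + 1) (.mk l true)) c) := by
    rw [Set.disjoint_union_right]
    refine ⟨h.disjoint_blockSet (by cases l <;> simp [Letter.mk]), ?_⟩
    rw [Set.disjoint_left]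
    rintro _ ⟨j, hj, rfl⟩ ⟨_, ⟨k, hk, rfl⟩, he⟩
    simp only [Set.mem_ofPred_eq] at hj hk
    have h1 : pos p m (p m k + 2) = pos p m (p m j) := (hnext k hk).trans he
    have h2 := hP.strictMono.injective h1
    have := (h.desub m).part.unique (k := k) (l := j) (r := 2) (s := 0)
      (by simp [hk, Letter.len, val]) (Letter.len_pos _) (by simpa using h2)
    simp at this
  rw [hset, hd.union _ _ hdisj', hd.union _ _ hdisj, hd.translate]
  ring

theorem IsTower.isFreq (h : IsTower τ z p) {d : Set ℤ → ℝ} (hd : IsDensity d) :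
    IsFreq τ (fun m => d (blockSet z p m .A) + d (blockSet z p m .C))
      (fun m => d (blockSet z p m .C)) (fun m => d (blockSet z p m .D)) := by
  have hn := fun m a => hd.nonneg (blockSet z p m a)
  have e0 : ∀ m, τ m = 0 →
      d (blockSet z p m .A) = d (blockSet z p (m + 1) .A) + 2 * d (blockSet z p (m + 1) .C) ∧
      d (blockSet z p m .B) = d (blockSet z p (m + 1) .C) ∧
      d (blockSet z p m .C) = d (blockSet z p (m + 1) .D) ∧
      d (blockSet z p m .D) = d (blockSet z p (m + 1) .B) + 2 * d (blockSet z p (m + 1) .D) := by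
    intro m hm
    have h1 := h.density_middle hd m
    have h2 := h.density_ends hd m
    simp only [hm, zero_ne_one, decide_false, Bool.xor_false] at h1 h2
    exact ⟨h2 false, h1 false, h1 true, h2 true⟩
  have e1 : ∀ m, τ m = 1 →
      d (blockSet z p m .B) = d (blockSet z p (m + 1) .A) + 2 * d (blockSet z p (m + 1) .C) ∧
      d (blockSet z p m .A) = d (blockSet z p (m + 1) .C) ∧
      d (blockSet z p m .D) = d (blockSet z p (m + 1) .D) ∧
      d (blockSet z p m .C) = d (blockSet z p (m + 1) .B) + 2 * d (blockSet z p (m + 1) .D) := by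
    intro m hm
    have h1 := h.density_middle hd m
    have h2 := h.density_ends hd m
    simp only [hm, decide_true, Bool.xor_true, Bool.not_not] at h1 h2
    exact ⟨h2 false, h1 false, h1 true, h2 true⟩
  have hb := h.density_balance hd
  refine ⟨?_, fun m => hn _ _, fun m => by linarith [hn m .A], fun m => hn _ _,
    fun m => by linarith [hb m, hn m .B], fun m => ?_, fun m hm => ?_, fun m hm => ?_⟩
  -- Level-`0` blocks are single letters and fill `ℤ`; the balance relation splits the total mass
  -- `1` into two halves.
  · have hu : (blockSet z p 0 .A ∪ blockSet z p 0 .C) ∪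
        (blockSet z p 0 .B ∪ blockSet z p 0 .D) = Set.univ := by
      refine Set.eq_univ_of_forall fun i => ?_
      cases hz : z 0 i
      · exact .inl (.inl ⟨i, hz, rfl⟩)
      · exact .inr (.inl ⟨i, hz, rfl⟩)
      · exact .inl (.inr ⟨i, hz, rfl⟩)
      · exact .inr (.inr ⟨i, hz, rfl⟩)
    have h1 := hd.univ
    have hdj : ∀ {a b : Letter}, a ≠ b → Disjoint (blockSet z p 0 a) (blockSet z p 0 b) :=
      h.disjoint_blockSet
    rw [← hu, hd.union, hd.union _ _ (hdj (by simp)), hd.union _ _ (hdj (by simp)), ← hb 0] at h1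
    · linarith
    · simp only [Set.disjoint_union_left, Set.disjoint_union_right]
      exact ⟨⟨hdj (by simp), hdj (by simp)⟩, hdj (by simp), hdj (by simp)⟩
  · have : τ m = 0 ∨ τ m = 1 := by omega
    rcases this with hm | hm
    · obtain ⟨h1, h2, h3, h4⟩ := e0 m hm
      linarith
    · obtain ⟨h1, h2, h3, h4⟩ := e1 m hm
      linarith [hb (m + 1)]
  · obtain ⟨h1, h2, h3, h4⟩ := e0 m hm
    exact ⟨h3, by linarith [hb (m + 1)]⟩
  · obtain ⟨h1, h2, h3, h4⟩ := e1 m hm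
    exact ⟨by linarith [hb (m + 1)], h3⟩

/-! ### Counting the occurrences of a word -/

open Classical in
/-- The positions `r` of the occurrences of `w` in the words of level `m`. -/
noncomputable def occurrencesIn (τ : ℕ → Fin 2) (m : ℕ) (w : List Letter) :
    Finset (Σ _ : Letter, ℕ) :=
  Finset.univ.sigma fun b => (Finset.range (word τ m b).length).filter fun r =>
    r + w.length ≤ (word τ m b).length ∧ ∀ k < w.length, (word τ m b)[r + k]? = w[k]?

/-- The main term counts the occurrences contained in a single level-`m` block. The remaining ones
start among the last `w.length` positions of a block, whence the error term. -/
theorem IsTower.abs_density_sub_le (h : IsTower τ z p) {d : Set ℤ → ℝ} (hd : IsDensity d)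
    (m : ℕ) (w : List Letter) :
    |d {i | OccursAt w (z 0) i} - ∑ x ∈ occurrencesIn τ m w, d (blockSet z p m x.1)| ≤
      w.length * ∑ b, d (blockSet z p m b) := by
  set G : Set ℤ := ⋃ x ∈ occurrencesIn τ m w, translate (blockSet z p m x.1) x.2 with hG
  -- Truncated subtraction can repeat an offset when a block is shorter than `w`; this is harmless,
  -- since `H` is only bounded above by subadditivity.
  set H : Set ℤ := ⋃ x ∈ (Finset.univ : Finset Letter) ×ˢ Finset.range w.length,
    translate (blockSet z p m x.1) ((word τ m x.1).length - 1 - x.2) with hH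
  have hocc : ∀ k r, r + w.length ≤ (word τ m (z m k)).length →
      (OccursAt w (z 0) (pos p m k + (r : ℕ)) ↔
        ∀ i < w.length, (word τ m (z m k))[r + i]? = w[i]?) := by
    intro k r hr
    have h1 := h.occursAt_word m k
    rw [occursAt_iff] at h1 ⊢
    refine forall₂_congr fun i hi => ?_
    rw [List.getElem?_eq_getElem hi, List.getElem?_eq_getElem (by omega), ← h1 (r + i) (by omega),
      Option.some_inj, Nat.cast_add, ← add_assoc]
  have hGd : d G = ∑ x ∈ occurrencesIn τ m w, d (blockSet z p m x.1) := by
    rw [hG, hd.biUnion]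
    · exact Finset.sum_congr rfl fun x _ => hd.translate _ _
    · rintro ⟨a, r⟩ hx ⟨b, s⟩ hy hne
      simp only [occurrencesIn, Finset.mem_sigma, Finset.mem_filter, Finset.mem_range] at hx hy
      refine h.disjoint_translate hx.2.1 hy.2.1 fun he => hne ?_
      simp only [Prod.mk.injEq] at he
      rw [he.1, he.2]
  have hHd : d H ≤ w.length * ∑ b, d (blockSet z p m b) := by
    refine (hd.biUnion_le _ _).trans (le_of_eq ?_)
    rw [Finset.sum_product, Finset.mul_sum]
    refine Finset.sum_congr rfl fun b _ => ?_
    simp [hd.translate]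
  have hsub : G ⊆ {i | OccursAt w (z 0) i} := by
    intro i hi
    simp only [hG, Set.mem_iUnion] at hi
    obtain ⟨⟨b, r⟩, hx, _, ⟨k, hk, rfl⟩, rfl⟩ := hi
    simp only [occurrencesIn, Finset.mem_sigma, Finset.mem_filter] at hx
    simp only [Set.mem_ofPred_eq] at hk
    subst hk
    exact (hocc k r hx.2.2.1).2 hx.2.2.2
  have hsup : {i | OccursAt w (z 0) i} ⊆ G ∪ H := by
    intro i hi
    obtain ⟨k, r, hr, rfl⟩ := (h.isPartition_pos m).cover i
    by_cases hle : r + w.length ≤ (word τ m (z m k)).length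
    · left
      simp only [hG, Set.mem_iUnion]
      refine ⟨⟨z m k, r⟩, ?_, _, ⟨k, rfl, rfl⟩, rfl⟩
      simp only [occurrencesIn, Finset.mem_sigma, Finset.mem_filter, Finset.mem_range,
        Finset.mem_univ, true_and]
      exact ⟨hr, hle, (hocc k r hle).1 hi⟩
    · right
      simp only [hH, Set.mem_iUnion]
      refine ⟨(z m k, (word τ m (z m k)).length - 1 - r), ?_, _, ⟨k, rfl, rfl⟩, ?_⟩
      · simp only [Finset.mem_product, Finset.mem_univ, Finset.mem_range, true_and]
        omega
      · simp only [add_right_inj, Nat.cast_inj]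
        omega
  have h1 := hd.mono hsub
  have h2 := (hd.mono hsup).trans (hd.union_le G H)
  rw [← hGd, abs_le]
  constructor <;> linarith [hd.nonneg H]

end Tower

theorem sum_letter (f : Letter → ℝ) : ∑ b, f b = f .A + f .B + f .C + f .D := by
  have : (Finset.univ : Finset Letter) = {.A, .B, .C, .D} := rfl
  rw [this]
  simp
  ring

/-- The main terms coincide, because the block densities depend only on `τ`; each of the two errors
is at most `2 * w.length` times the density of `{A, C}`-blocks, which tends to `0`. -/
theorem density_occursAt_eq {τ : ℕ → Fin 2} {z z' : ℕ → ℤ → Letter} {p p' : ℕ → ℤ → ℤ}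
    (h : IsTower τ z p) (h' : IsTower τ z' p') {d d' : Set ℤ → ℝ} (hd : IsDensity d)
    (hd' : IsDensity d') (w : List Letter) :
    d {i | OccursAt w (z 0) i} = d' {i | OccursAt w (z' 0) i} := by
  have hF := h.isFreq hd
  have heq : ∀ m a, d (blockSet z p m a) = d' (blockSet z' p' m a) := by
    intro m a
    obtain ⟨h1, h2, h3⟩ := hF.eq (h'.isFreq hd') m
    have h4 := h.density_balance hd m
    have h5 := h'.density_balance hd' m
    cases a <;> linarith
  have hlim : Tendsto (fun m => 4 * w.length * (d (blockSet z p m .A) + d (blockSet z p m .C)))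
      atTop (𝓝 0) := by
    simpa using hF.tendsto.const_mul (4 * w.length : ℝ)
  refine sub_eq_zero.1 (abs_nonpos_iff.1 (ge_of_tendsto' hlim fun m => ?_))
  have h1 := h.abs_density_sub_le hd m w
  have h2 := h'.abs_density_sub_le hd' m w
  simp only [← heq] at h2
  have h3 : ∑ b, d (blockSet z p m b) = 2 * (d (blockSet z p m .A) + d (blockSet z p m .C)) := by
    rw [sum_letter]
    linarith [h.density_balance hd m]
  rw [h3] at h1 h2
  rw [abs_le] at *
  constructor <;> linarith

theorem exists_frequency (τ : ℕ → Fin 2) : ∃ v : List Letter → ℝ, ∀ y ∈ recodedSet τ,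
    ∀ w, Tendsto (average {i | OccursAt w y i}) atTop (𝓝 (v w)) := by
  -- A reference pair supplies the values; without one, the condition on all densities holds
  -- vacuously.
  by_cases hne : ∃ y d, y ∈ recodedSet τ ∧ IsDensity d
  · obtain ⟨y₀, d₀, hy₀, hd₀⟩ := hne
    refine ⟨fun w => d₀ {i | OccursAt w y₀ i}, fun y hy w => tendsto_average fun d hd => ?_⟩
    obtain ⟨z, p, h, rfl⟩ := exists_tower hy
    obtain ⟨z', p', h', rfl⟩ := exists_tower hy₀
    exact density_occursAt_eq h h' hd hd₀ w
  · exact ⟨0, fun y hy w => tendsto_average fun d hd => absurd ⟨y, d, hy, hd⟩ hne⟩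

/-! ### The subshift -/

/-- The sequences `z` and the offsets `j` such that `z n` is alternating, and is obtained from
`z (n + 1)` by the substitution `sub (τ n)` and a translation by `j n`. -/
def levelSet (τ : ℕ → Fin 2) (n : ℕ) : Set ((ℕ → ℤ → Letter) × (ℕ → Fin 3)) :=
  {ω | Alternating (ω.1 n) ∧ ∀ k, ∀ r < (ω.1 (n + 1) k).len,
    ω.1 n (starts (ω.1 (n + 1)) k - ((ω.2 n : ℕ) : ℤ) + (r : ℕ)) = sub (τ n) (ω.1 (n + 1) k) r}

theorem continuous_starts (k : ℤ) : Continuous fun z : ℤ → Letter => starts z k := by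
  have h : ∀ i : ℤ, Continuous fun z : ℤ → Letter => ((z i).len : ℤ) := fun i =>
    (continuous_of_discreteTopology (f := fun a : Letter => (a.len : ℤ))).comp (continuous_apply i)
  unfold starts
  fun_prop

/-- The index is locally constant because `ℤ` is discrete. -/
theorem continuous_eval {α : Type*} [TopologicalSpace α] {y : α → ℤ → Letter} {i : α → ℤ}
    (hy : Continuous y) (hi : Continuous i) : Continuous fun a => y a (i a) := by
  rw [continuous_iff_continuousAt]
  intro a
  have h1 : ContinuousAt (fun b => y b (i a)) a :=
    ((continuous_apply (i a)).comp hy).continuousAt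
  refine h1.congr ?_
  have h2 : ∀ᶠ b in 𝓝 a, i b = i a :=
    hi.continuousAt.eventually_mem ((isOpen_discrete {i a}).mem_nhds rfl)
  filter_upwards [h2] with b hb
  rw [hb]

theorem isClosed_setOf_of_continuous {α β : Type*} [TopologicalSpace α] [TopologicalSpace β]
    [DiscreteTopology β] {f : α → β} (hf : Continuous f) (P : β → Prop) :
    IsClosed {a | P (f a)} :=
  (isClosed_discrete {b | P b}).preimage hf

theorem isClosed_levelSet (τ : ℕ → Fin 2) (n : ℕ) : IsClosed (levelSet τ n) := by
  have hz : ∀ n i, Continuous fun ω : (ℕ → ℤ → Letter) × (ℕ → Fin 3) => ω.1 n i := by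
    intro n i; fun_prop
  simp only [levelSet, Set.ofPred_and, Set.ofPred_forall, Alternating]
  refine IsClosed.inter (isClosed_iInter fun k => ?_) (isClosed_iInter fun k =>
    isClosed_iInter fun r => ?_)
  · exact isClosed_setOf_of_continuous ((hz n (k + 1)).prodMk (hz n k))
      fun b => b.1.sym = !b.2.sym
  · have hi : Continuous fun ω : (ℕ → ℤ → Letter) × (ℕ → Fin 3) =>
        starts (ω.1 (n + 1)) k - ((ω.2 n : ℕ) : ℤ) + (r : ℕ) := by
      have h1 : Continuous fun ω : (ℕ → ℤ → Letter) × (ℕ → Fin 3) => starts (ω.1 (n + 1)) k :=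
        (continuous_starts k).comp (by fun_prop)
      have h2 : Continuous fun ω : (ℕ → ℤ → Letter) × (ℕ → Fin 3) => ((ω.2 n : ℕ) : ℤ) :=
        (continuous_of_discreteTopology (f := fun a : Fin 3 => ((a : ℕ) : ℤ))).comp (by fun_prop)
      exact (h1.sub h2).add continuous_const
    have he := continuous_eval (y := fun ω : (ℕ → ℤ → Letter) × (ℕ → Fin 3) => ω.1 n)
      (by fun_prop) hi
    have := isClosed_setOf_of_continuous (he.prodMk (hz (n + 1) k))
      fun b => r < b.2.len → b.1 = sub (τ n) b.2 r
    simpa only [Set.ofPred_forall] using this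

/-- A partition is determined by its lengths and one starting point, which after normalization lies
in `{0, -1, -2}`. Finitely many offsets per level make the space of towers compact, so its
projection is closed. -/
theorem recodedSet_eq_image (τ : ℕ → Fin 2) :
    recodedSet τ = (fun ω => ω.1 0) '' ⋂ n, levelSet τ n := by
  ext y
  rw [mem_recodedSet_iff]
  constructor
  · rintro ⟨z, p, h, rfl⟩
    obtain ⟨z', p', h', h0, hn⟩ := h.exists_normalized 0
    have hp : ∀ n k, p' n k = starts (z' (n + 1)) k + p' n 0 := by
      intro n k
      have h1 := (h'.desub n).part.step
      have h2 := (isPartition_starts (z' (n + 1))).step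
      induction k using Int.induction_on with
      | zero => simp
      | succ i ih => rw [h1, h2, ih]; ring
      | pred i ih =>
        have h3 := h1 (-(i : ℤ) - 1)
        have h4 := h2 (-(i : ℤ) - 1)
        rw [sub_add_cancel] at h3 h4
        omega
    have hlt : ∀ n, (-p' n 0).toNat < 3 := by
      intro n
      have h1 := (h'.desub n).part.step 0
      have h2 := (z' (n + 1) 0).len_le
      have h3 := hn n
      rw [zero_add] at h1
      omega
    refine ⟨(z', fun n => ⟨(-p' n 0).toNat, hlt n⟩), Set.mem_iInter.2 fun n =>
      ⟨h'.alt n, fun k r hr => ?_⟩, by simp [h0]⟩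
    simp only at hr ⊢
    rw [← (h'.desub n).apply k r hr, hp n k]
    congr 2
    have := (hn n).1
    omega
  · rintro ⟨⟨z, j⟩, h, rfl⟩
    rw [Set.mem_iInter] at h
    refine ⟨z, fun n k => starts (z (n + 1)) k - ((j n : ℕ) : ℤ), ⟨fun n => (h n).1, fun n =>
      ⟨⟨fun k => Letter.len_pos _, fun k => ?_⟩, (h n).2⟩⟩, rfl⟩
    rw [(isPartition_starts _).step]
    ring

theorem isClosed_recodedSet (τ : ℕ → Fin 2) : IsClosed (recodedSet τ) := by
  rw [recodedSet_eq_image]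
  exact ((isClosed_iInter fun n => isClosed_levelSet τ n).isCompact.image (by fun_prop)).isClosed

/-- Images have odd length, so each ends with the symbol it begins with; the alternation of `z` then
makes consecutive images fit together. -/
theorem exists_alternating_sub (t : Fin 2) {z : ℤ → Letter} (hz : Alternating z) :
    ∃ y, Alternating y ∧ ∀ k, ∀ r < (z k).len, y (starts z k + (r : ℕ)) = sub t (z k) r := by
  have hP := isPartition_starts z
  obtain ⟨y, hy⟩ := hP.exists_fun fun k r => sub t (z k) r
  refine ⟨y, fun i => ?_, hy⟩
  obtain ⟨k, r, hr, rfl⟩ := hP.cover i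
  rw [hy k r hr]
  rcases Nat.lt_or_ge (r + 1) (z k).len with h | h
  · have := hy k (r + 1) h
    rw [add_assoc, show (r : ℤ) + 1 = (r + 1 : ℕ) by push_cast; rfl, this]
    rcases Nat.mod_two_eq_zero_or_one r with h0 | h0 <;> simp [sub, h0, Nat.add_mod]
  · have h1 := hy (k + 1) 0 (Letter.len_pos _)
    have h2 := hP.step k
    have h3 : (z k).len = r + 1 := by omega
    have h4 : r % 2 = 0 := by
      have : (z k).len % 2 = 1 := by rw [Letter.len]; cases (z k).long <;> simp [val]
      omega
    rw [h2, h3] at h1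
    rw [add_assoc, show (r : ℤ) + 1 = (r + 1 : ℕ) by push_cast; rfl]
    simp only [Nat.cast_zero, add_zero] at h1
    rw [h1]
    simp [sub, h4, hz k]

/-- A finite tower is built downwards, by substituting into an arbitrary alternating sequence.
Compactness later turns these into an infinite tower. -/
theorem exists_forall_lt_mem_levelSet (N : ℕ) (τ : ℕ → Fin 2) :
    ∃ ω, Alternating (ω.1 0) ∧ ∀ n < N, ω ∈ levelSet τ n := by
  induction N generalizing τ with
  | zero =>
    refine ⟨(fun _ i => if i % 2 = 0 then .A else .B, fun _ => 0), fun k => ?_, by simp⟩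
    rcases Int.emod_two_eq_zero_or_one k with h | h <;> simp [h, Int.add_emod, Letter.sym]
  | succ N ih =>
    obtain ⟨⟨z, j⟩, h0, h⟩ := ih fun n => τ (n + 1)
    obtain ⟨y, hy, hy'⟩ := exists_alternating_sub (τ 0) h0
    refine ⟨(fun n => Nat.casesOn n y z, fun n => Nat.casesOn n 0 j), hy, fun n hn => ?_⟩
    cases n with
    | zero => exact ⟨hy, fun k r hr => by simpa using hy' k r hr⟩
    | succ n => exact h n (by omega)

theorem recodedSet_nonempty (τ : ℕ → Fin 2) : (recodedSet τ).Nonempty := by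
  rw [recodedSet_eq_image, Set.image_nonempty]
  have hcl : ∀ N, IsClosed (⋂ n < N, levelSet τ n) := fun N =>
    isClosed_biInter fun n _ => isClosed_levelSet τ n
  obtain ⟨ω, hω⟩ := IsCompact.nonempty_iInter_of_sequence_nonempty_isCompact_isClosed
    (fun N => ⋂ n < N, levelSet τ n)
    (fun N => Set.biInter_subset_biInter_left fun n hn => Nat.lt_succ_of_lt hn)
    (fun N => by
      obtain ⟨ω, -, hω⟩ := exists_forall_lt_mem_levelSet N τ
      exact ⟨ω, Set.mem_iInter₂.2 hω⟩) (hcl 0).isCompact hcl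
  refine ⟨ω, Set.mem_iInter.2 fun n => ?_⟩
  exact Set.mem_iInter₂.1 (Set.mem_iInter.1 hω (n + 1)) n (Nat.lt_succ_self n)

theorem shift_iterate (y : ℤ → Letter) (n : ℕ) : shift^[n] y = fun l => y (l + n) := by
  induction n with
  | zero => simp
  | succ n ih =>
    rw [Function.iterate_succ_apply', ih]
    funext l
    simp only [shift]
    congr 1
    push_cast
    ring

theorem isSubshift_recodedSet (τ : ℕ → Fin 2) : IsSubshift (recodedSet τ) := by
  refine ⟨recodedSet_nonempty τ, isClosed_recodedSet τ, Set.Subset.antisymm ?_ fun y hy => ?_⟩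
  · rintro _ ⟨y, hy, rfl⟩
    exact shift_mem_recodedSet hy 1
  · exact ⟨_, shift_mem_recodedSet hy (-1), by funext l; simp [shift]⟩

/-! ### Cylinders and empirical measures -/

/-- The cylinder set of the sequences in which `w` occurs at the position `i`. -/
def cylinderAt (i : ℤ) (w : List Letter) : Set (ℤ → Letter) := {y | OccursAt w y i}

theorem isClopen_cylinderAt (i : ℤ) (w : List Letter) : IsClopen (cylinderAt i w) := by
  simp only [cylinderAt, OccursAt, Set.ofPred_forall]
  exact isClopen_iInter_of_finite fun k =>
    (isClopen_discrete {w.get k}).preimage (continuous_apply (i + ((k : ℕ) : ℤ)))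

theorem measurableSet_cylinderAt (i : ℤ) (w : List Letter) : MeasurableSet (cylinderAt i w) :=
  (isClopen_cylinderAt i w).isOpen.measurableSet

theorem occursAt_add {w : List Letter} {y : ℤ → Letter} {i j : ℤ} :
    OccursAt w (fun l => y (l + j)) i ↔ OccursAt w y (i + j) := by
  simp only [OccursAt, add_right_comm]

/-- The sequences that agree with `y` on `[-k, k]`. -/
def agreeSet (k : ℕ) (y : ℤ → Letter) : Set (ℤ → Letter) :=
  {u | ∀ i : ℤ, -k ≤ i → i ≤ k → u i = y i}

theorem agreeSet_eq (k : ℕ) (y : ℤ → Letter) :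
    agreeSet k y = cylinderAt (-k) (List.ofFn fun j : Fin (2 * k + 1) => y (-k + (j : ℕ))) := by
  ext u
  simp only [agreeSet, cylinderAt, Set.mem_ofPred_eq, occursAt_iff, List.length_ofFn,
    List.getElem_ofFn]
  constructor
  · exact fun h j hj => h _ (by omega) (by omega)
  · intro h i h1 h2
    have := h (i + k).toNat (by omega)
    rwa [show -(k : ℤ) + ((i + k).toNat : ℤ) = i by omega] at this

theorem agreeSet_inter {k k' : ℕ} {u y y' : ℤ → Letter} (h : u ∈ agreeSet k y ∩ agreeSet k' y') :
    agreeSet k y ∩ agreeSet k' y' = agreeSet (max k k') u := by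
  ext x
  constructor
  · rintro ⟨h1, h2⟩ i hi hi'
    rcases le_total k k' with hk | hk
    · rw [max_eq_right hk] at hi hi'
      rw [h2 i hi hi', h.2 i hi hi']
    · rw [max_eq_left hk] at hi hi'
      rw [h1 i hi hi', h.1 i hi hi']
  · intro hx
    have h1 := le_max_left k k'
    have h2 := le_max_right k k'
    exact ⟨fun i hi hi' => by rw [hx i (by omega) (by omega), h.1 i hi hi'],
      fun i hi hi' => by rw [hx i (by omega) (by omega), h.2 i hi hi']⟩

/-- There are only countably many such sets, as each is a cylinder of a finite word; so the open set
where a coordinate has a given value is a countable union of them. -/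
theorem generateFrom_agreeSet : (MeasurableSpace.pi : MeasurableSpace (ℤ → Letter)) =
    MeasurableSpace.generateFrom (Set.range fun a : ℕ × (ℤ → Letter) => agreeSet a.1 a.2) := by
  have hcount : (Set.range fun a : ℕ × (ℤ → Letter) => agreeSet a.1 a.2).Countable := by
    refine (Set.countable_range fun a : ℕ × List Letter => cylinderAt (-a.1) a.2).mono ?_
    rintro _ ⟨⟨k, y⟩, rfl⟩
    exact ⟨(k, _), (agreeSet_eq k y).symm⟩
  refine le_antisymm (iSup_le fun i => ?_) (MeasurableSpace.generateFrom_le ?_)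
  · rw [← measurable_iff_comap_le]
    refine @measurable_to_countable' _ _ _ _ (_) _ fun a => ?_
    have : (fun y : ℤ → Letter => y i) ⁻¹' {a} =
        ⋃₀ {N ∈ Set.range fun a : ℕ × (ℤ → Letter) => agreeSet a.1 a.2 |
          N ⊆ (fun y : ℤ → Letter => y i) ⁻¹' {a}} := by
      refine Set.Subset.antisymm (fun y hy => ?_) (Set.sUnion_subset fun N hN => hN.2)
      refine ⟨agreeSet i.natAbs y, ⟨⟨(i.natAbs, y), rfl⟩, fun u hu => ?_⟩, fun _ _ _ => rfl⟩
      exact (hu i (by omega) (by omega)).trans hy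
    rw [this]
    exact MeasurableSet.sUnion (hcount.mono fun N hN => hN.1)
      fun N hN => MeasurableSpace.measurableSet_generateFrom hN.1
  · rintro _ ⟨⟨k, y⟩, rfl⟩
    simp only [agreeSet_eq]
    exact measurableSet_cylinderAt _ _

/-- The sets `agreeSet k y` are cylinders and form a π-system: when two of them meet, their
intersection is again one, centred at any common point. -/
theorem probabilityMeasure_ext {μ ν : ProbabilityMeasure (ℤ → Letter)}
    (h : ∀ i w, μ (cylinderAt i w) = ν (cylinderAt i w)) : μ = ν := by
  refine Subtype.ext (ext_of_generate_finite (μ := (μ : Measure (ℤ → Letter))) _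
    generateFrom_agreeSet ?_ ?_ (by simp))
  · rintro _ ⟨⟨k, y⟩, rfl⟩ _ ⟨⟨k', y'⟩, rfl⟩ ⟨u, hu⟩
    exact ⟨(max k k', u), (agreeSet_inter hu).symm⟩
  · rintro _ ⟨⟨k, y⟩, rfl⟩
    simp only [agreeSet_eq]
    have := congrArg ENNReal.ofNNReal
      (h (-k) (List.ofFn fun j : Fin (2 * k + 1) => y (-k + (j : ℕ))))
    rwa [ProbabilityMeasure.ennreal_coeFn_eq_coeFn_toMeasure,
      ProbabilityMeasure.ennreal_coeFn_eq_coeFn_toMeasure] at this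

theorem average_eq_sum_Icc (E : Set ℤ) (n : ℕ) :
    average E n = (∑ j ∈ Finset.Icc 1 n, E.indicator (1 : ℤ → ℝ) (j : ℤ)) / n := by
  rw [average, Finset.range_eq_Ico]
  have := Finset.sum_Ico_add' (fun j : ℕ => E.indicator (1 : ℤ → ℝ) (j : ℤ)) 0 n 1
  push_cast at this
  rw [this, Finset.Ico_add_one_right_eq_Icc]

theorem empiricalMeasure_apply (y : ℤ → Letter) (n : ℕ+) {E : Set (ℤ → Letter)}
    (hE : MeasurableSet E) :
    ((empiricalMeasure y n E : ℝ≥0) : ℝ) = average {j | (fun l => y (l + j)) ∈ E} n := by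
  have h : ((empiricalMeasure y n : Measure (ℤ → Letter)) E).toReal =
      average {j | (fun l => y (l + j)) ∈ E} n := by
    change ((((n : ℕ) : ℝ≥0∞)⁻¹ • ∑ j ∈ Finset.Icc 1 (n : ℕ), Measure.dirac (shift^[j] y)) E).toReal
      = _
    rw [Measure.smul_apply, Measure.finsetSum_apply, smul_eq_mul, ENNReal.toReal_mul,
      ENNReal.toReal_sum (fun j _ => measure_ne_top _ _), average_eq_sum_Icc, div_eq_inv_mul]
    congr 1
    · simp
    · refine Finset.sum_congr rfl fun j _ => ?_
      rw [Measure.dirac_apply' _ hE, shift_iterate]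
      by_cases hj : (fun l => y (l + j)) ∈ E <;> simp [Set.indicator, hj]
  rw [← h]
  rfl

/-- The position `i` of the cylinder is absorbed by translating `y`, which stays in `recodedSet τ`;
the limit is therefore independent of `i`. -/
theorem tendsto_average_cylinderAt {τ : ℕ → Fin 2} {v : List Letter → ℝ}
    (hv : ∀ y ∈ recodedSet τ, ∀ w, Tendsto (average {i | OccursAt w y i}) atTop (𝓝 (v w)))
    {y : ℤ → Letter} (hy : y ∈ recodedSet τ) (i : ℤ) (w : List Letter) :
    Tendsto (average {j | (fun l => y (l + j)) ∈ cylinderAt i w}) atTop (𝓝 (v w)) := by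
  convert hv _ (shift_mem_recodedSet hy i) w using 4 with j
  change OccursAt w (fun l => y (l + j)) i ↔ OccursAt w (fun l => y (l + i)) j
  rw [occursAt_add, occursAt_add, add_comm]

theorem tendsto_pnat_val : Tendsto (fun n : ℕ+ => (n : ℕ)) atTop atTop :=
  tendsto_atTop_mono' atTop (Eventually.of_forall fun _ => le_rfl)
    (Monotone.tendsto_atTop_atTop (fun _ _ h => h) fun b => ⟨b.succPNat, Nat.le_succ b⟩)

/-- A limit of the empirical measures gives to each cylinder the frequency of the word. -/
theorem apply_cylinderAt_of_tendsto {τ : ℕ → Fin 2} {v : List Letter → ℝ}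
    (hv : ∀ y ∈ recodedSet τ, ∀ w, Tendsto (average {i | OccursAt w y i}) atTop (𝓝 (v w)))
    {y : ℤ → Letter} (hy : y ∈ recodedSet τ) {ι : Type*} {l : Filter ι} [l.NeBot] {n : ι → ℕ+}
    (hn : Tendsto (fun k => (n k : ℕ)) l atTop) {ν : ProbabilityMeasure (ℤ → Letter)}
    (hν : Tendsto (fun k => empiricalMeasure y (n k)) l (𝓝 ν)) (i : ℤ) (w : List Letter) :
    ((ν (cylinderAt i w) : ℝ≥0) : ℝ) = v w := by
  have h1 := ProbabilityMeasure.tendsto_measure_of_isClopen_of_tendsto hν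
    (isClopen_cylinderAt i w)
  have h2 := (NNReal.continuous_coe.tendsto _).comp h1
  refine tendsto_nhds_unique h2 (((tendsto_average_cylinderAt hv hy i w).comp hn).congr fun k => ?_)
  exact (empiricalMeasure_apply y (n k) (measurableSet_cylinderAt i w)).symm

theorem abs_occurrences_sub_le (w : List Letter) (y : ℤ → Letter) (n : ℕ) :
    |(occurrences w y n : ℝ) / n - average {i | OccursAt w y i} n| ≤ w.length / n := by
  classical
  have h1 : (∑ j ∈ Finset.Icc 1 n, {i | OccursAt w y i}.indicator (1 : ℤ → ℝ) (j : ℤ)) =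
      ((Finset.Icc 1 n).filter fun j : ℕ => OccursAt w y j).card := by
    simp [Set.indicator_apply, Finset.sum_boole]
  rw [average_eq_sum_Icc, h1, ← sub_div, abs_div, Nat.abs_cast]
  have h2 : occurrences w y n ≤ ((Finset.Icc 1 n).filter fun j : ℕ => OccursAt w y j).card := by
    unfold occurrences
    refine Finset.card_le_card fun j hj => ?_
    simp only [Finset.mem_filter] at hj ⊢
    exact ⟨hj.1, hj.2.2⟩
  have h3 : ((Finset.Icc 1 n).filter fun j : ℕ => OccursAt w y j).card ≤
      occurrences w y n + w.length := by
    -- An occurrence that starts in `[1, n]` but overflows has `j + w.length ≥ n + 2`, leaving at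
    -- most `w.length` values of `j`.
    have h4 : ((Finset.Icc 1 n).filter fun j : ℕ => OccursAt w y j) ⊆
        ((Finset.Icc 1 n).filter fun j : ℕ => j + w.length ≤ n + 1 ∧ OccursAt w y j) ∪
          Finset.Icc (n + 2 - w.length) n := by
      intro j hj
      simp only [Finset.mem_filter, Finset.mem_union, Finset.mem_Icc] at hj ⊢
      by_cases hle : j + w.length ≤ n + 1
      · exact .inl ⟨hj.1, hle, hj.2⟩
      · exact .inr ⟨by omega, hj.1.2⟩
    have h5 := (Finset.card_le_card h4).trans (Finset.card_union_le _ _)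
    rw [Nat.card_Icc] at h5
    unfold occurrences
    refine h5.trans ?_
    have : n + 1 - (n + 2 - w.length) ≤ w.length := by omega
    convert Nat.add_le_add_left this _
  gcongr
  have h2' : (occurrences w y n : ℝ) ≤ _ := Nat.cast_le.2 h2
  have h3' := (Nat.cast_le (α := ℝ)).2 h3
  push_cast at h3'
  rw [abs_le]
  constructor <;> linarith [(Nat.cast_nonneg w.length : (0 : ℝ) ≤ _)]

theorem tendsto_occurrences {w : List Letter} {y : ℤ → Letter} {v : ℝ}
    (h : Tendsto (average {i | OccursAt w y i}) atTop (𝓝 v)) :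
    Tendsto (fun n : ℕ => (occurrences w y n : ℝ) / n) atTop (𝓝 v) := by
  have h1 : Tendsto (fun n : ℕ => (w.length : ℝ) / n) atTop (𝓝 0) :=
    tendsto_const_div_atTop_nhds_zero_nat _
  have h2 : Tendsto (fun n : ℕ => (occurrences w y n : ℝ) / n - average {i | OccursAt w y i} n)
      atTop (𝓝 0) := squeeze_zero_norm (abs_occurrences_sub_le w y) h1
  simpa using h2.add h

/-! ### Invariant measures -/

theorem continuous_shift : Continuous shift :=
  continuous_pi fun n => continuous_apply (n + 1)

theorem measurable_average (E : Set (ℤ → Letter)) (hE : MeasurableSet E) (n : ℕ) :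
    Measurable fun y : ℤ → Letter => average {j | (fun l => y (l + j)) ∈ E} n := by
  unfold average
  refine Measurable.div_const (Finset.measurable_fun_sum _ fun j _ => ?_) _
  have hm : Measurable fun (y : ℤ → Letter) (l : ℤ) => y (l + ((j : ℤ) + 1)) :=
    measurable_pi_lambda _ fun l => measurable_pi_apply _
  exact (measurable_one.indicator (hm hE) : Measurable
    (((fun (y : ℤ → Letter) (l : ℤ) => y (l + ((j : ℤ) + 1))) ⁻¹' E).indicator
      (1 : (ℤ → Letter) → ℝ)))

theorem integral_average {μ : ProbabilityMeasure (ℤ → Letter)}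
    (hμ : MeasurePreserving shift (μ : Measure (ℤ → Letter)) (μ : Measure (ℤ → Letter)))
    {E : Set (ℤ → Letter)} (hE : MeasurableSet E) {n : ℕ} (hn : 0 < n) :
    ∫ y, average {j | (fun l => y (l + j)) ∈ E} n ∂(μ : Measure (ℤ → Letter)) =
      ((μ E : ℝ≥0) : ℝ) := by
  have hj : ∀ j : ℕ, (fun y : ℤ → Letter =>
      {j : ℤ | (fun l => y (l + j)) ∈ E}.indicator (1 : ℤ → ℝ) ((j : ℤ) + 1)) =
      (shift^[j + 1] ⁻¹' E).indicator (1 : (ℤ → Letter) → ℝ) := by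
    intro j
    funext y
    have h : (j : ℤ) + 1 ∈ {j : ℤ | (fun l => y (l + j)) ∈ E} ↔ y ∈ shift^[j + 1] ⁻¹' E := by
      rw [Set.mem_preimage, shift_iterate]
      push_cast
      rfl
    by_cases hy : y ∈ shift^[j + 1] ⁻¹' E
    · rw [Set.indicator_of_mem hy, Set.indicator_of_mem (h.2 hy)]
      rfl
    · rw [Set.indicator_of_notMem hy, Set.indicator_of_notMem fun h' => hy (h.1 h')]
  have hm : ∀ j : ℕ, MeasurableSet (shift^[j + 1] ⁻¹' E) := fun j =>
    (hμ.iterate (j + 1)).measurable hE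
  have hint : ∀ j : ℕ, ∫ y, {j : ℤ | (fun l => y (l + j)) ∈ E}.indicator (1 : ℤ → ℝ) ((j : ℤ) + 1)
      ∂(μ : Measure (ℤ → Letter)) = ((μ E : ℝ≥0) : ℝ) := by
    intro j
    rw [hj, integral_indicator_one (hm j), Measure.real,
      (hμ.iterate (j + 1)).measure_preimage hE.nullMeasurableSet]
    rfl
  have hn' : (n : ℝ) ≠ 0 := by positivity
  simp only [average]
  rw [integral_div, integral_finsetSum]
  · simp only [hint]
    simp [hn']
  · intro j _
    rw [hj]
    exact (integrable_const (1 : ℝ)).indicator (hm j)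

/-- By invariance, every average has integral equal to the mass of the cylinder. The averages
converge at every point of `recodedSet τ`, so dominated convergence suffices and no ergodic theorem
is needed. -/
theorem apply_cylinderAt_of_invariant {τ : ℕ → Fin 2} {v : List Letter → ℝ}
    (hv : ∀ y ∈ recodedSet τ, ∀ w, Tendsto (average {i | OccursAt w y i}) atTop (𝓝 (v w)))
    {μ : ProbabilityMeasure (ℤ → Letter)} (hμ : μ ∈ invariantMeasures (recodedSet τ))
    (i : ℤ) (w : List Letter) : ((μ (cylinderAt i w) : ℝ≥0) : ℝ) = v w := by
  have hE := measurableSet_cylinderAt i w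
  have hae : ∀ᵐ y ∂(μ : Measure (ℤ → Letter)), y ∈ recodedSet τ := by
    have h1 : (μ : Measure (ℤ → Letter)) (recodedSet τ) = 1 := by
      rw [← ProbabilityMeasure.ennreal_coeFn_eq_coeFn_toMeasure, hμ.1]; rfl
    exact (prob_compl_eq_zero_iff (isClosed_recodedSet τ).measurableSet).2 h1
  have h := tendsto_integral_of_dominated_convergence (μ := (μ : Measure (ℤ → Letter)))
    (F := fun n y => average {j | (fun l => y (l + j)) ∈ cylinderAt i w} n) (f := fun _ => v w)
    (fun _ => 1) (fun n => (measurable_average _ hE n).aestronglyMeasurable)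
    (integrable_const _)
    (fun n => Eventually.of_forall fun y => by
      have := average_mem {j | (fun l => y (l + j)) ∈ cylinderAt i w} n
      rw [Real.norm_of_nonneg this.1]
      exact this.2)
    (hae.mono fun y hy => tendsto_average_cylinderAt hv hy i w)
  rw [integral_const, probReal_univ, one_smul] at h
  refine tendsto_nhds_unique (tendsto_const_nhds.congr' ?_) h
  filter_upwards [eventually_gt_atTop 0] with n hn
  exact (integral_average hμ.2 hE hn).symm

/-- Full mass passes to the limit because `recodedSet τ` is closed. Invariance holds because the
mass of a cylinder does not depend on its position. -/
theorem mem_invariantMeasures_of_tendsto {τ : ℕ → Fin 2} {v : List Letter → ℝ}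
    (hv : ∀ y ∈ recodedSet τ, ∀ w, Tendsto (average {i | OccursAt w y i}) atTop (𝓝 (v w)))
    {y : ℤ → Letter} (hy : y ∈ recodedSet τ) {ν : ProbabilityMeasure (ℤ → Letter)}
    (hν : Tendsto (fun n => empiricalMeasure y n) atTop (𝓝 ν)) :
    ν ∈ invariantMeasures (recodedSet τ) := by
  have hcl := isClosed_recodedSet τ
  have hcyl := apply_cylinderAt_of_tendsto hv hy tendsto_pnat_val hν
  refine ⟨?_, continuous_shift.measurable, ?_⟩
  · have h1 : ∀ n : ℕ+, (empiricalMeasure y n : Measure (ℤ → Letter)) (recodedSet τ) = 1 := by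
      intro n
      rw [← ProbabilityMeasure.ennreal_coeFn_eq_coeFn_toMeasure]
      have h2 := empiricalMeasure_apply y n hcl.measurableSet
      have h3 : {j : ℤ | (fun l => y (l + j)) ∈ recodedSet τ} = Set.univ :=
        Set.eq_univ_of_forall fun j => shift_mem_recodedSet hy j
      rw [h3] at h2
      have h4 : empiricalMeasure y n (recodedSet τ) = 1 := by
        rw [← NNReal.coe_inj, h2]
        simp [average]
      rw [h4]; rfl
    have h2 := ProbabilityMeasure.limsup_measure_closed_le_of_tendsto hν hcl
    simp only [h1, limsup_const] at h2
    have h3 : (ν : Measure (ℤ → Letter)) (recodedSet τ) = 1 := le_antisymm prob_le_one h2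
    rw [← ENNReal.coe_inj, ProbabilityMeasure.ennreal_coeFn_eq_coeFn_toMeasure, h3]; rfl
  · have hmap : ν.map continuous_shift.measurable.aemeasurable = ν := by
      refine probabilityMeasure_ext fun i w => ?_
      rw [ProbabilityMeasure.map_apply _ _ (measurableSet_cylinderAt i w)]
      have : shift ⁻¹' cylinderAt i w = cylinderAt (i + 1) w := by
        ext u
        exact occursAt_add
      rw [this, ← NNReal.coe_inj, hcyl, hcyl]
    exact congrArg (fun μ : ProbabilityMeasure (ℤ → Letter) => (μ : Measure (ℤ → Letter))) hmap

/-- The probability measures on a compact space form a compact space, so a limit exists along each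
ultrafilter; all these limits share their cylinder values and hence coincide. -/
theorem exists_tendsto_empiricalMeasure {τ : ℕ → Fin 2} {v : List Letter → ℝ}
    (hv : ∀ y ∈ recodedSet τ, ∀ w, Tendsto (average {i | OccursAt w y i}) atTop (𝓝 (v w))) :
    ∃ ν : ProbabilityMeasure (ℤ → Letter), ∀ y ∈ recodedSet τ,
      Tendsto (fun n => empiricalMeasure y n) atTop (𝓝 ν) := by
  have hlim : ∀ y ∈ recodedSet τ, ∀ U : Ultrafilter ℕ+, (U : Filter ℕ+) ≤ atTop →
      ∃ ν : ProbabilityMeasure (ℤ → Letter), Tendsto (fun n => empiricalMeasure y n) U (𝓝 ν) ∧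
        ∀ i w, ((ν (cylinderAt i w) : ℝ≥0) : ℝ) = v w := by
    intro y hy U hU
    obtain ⟨ν, -, hν⟩ := isCompact_univ.ultrafilter_le_nhds
      (U.map fun n => empiricalMeasure y n) (by simp)
    exact ⟨ν, hν, apply_cylinderAt_of_tendsto hv hy (tendsto_pnat_val.mono_left hU) hν⟩
  obtain ⟨y₀, hy₀⟩ := recodedSet_nonempty τ
  obtain ⟨ν, -, hν⟩ := hlim y₀ hy₀ (Ultrafilter.of atTop) (Ultrafilter.of_le _)
  refine ⟨ν, fun y hy => (tendsto_iff_ultrafilter _ _ _).2 fun U hU => ?_⟩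
  obtain ⟨ν', hν', h⟩ := hlim y hy U hU
  have : ν' = ν := probabilityMeasure_ext fun i w => by rw [← NNReal.coe_inj, h, hν]
  exact this ▸ hν'

end SmoothSeq

theorem proposition3p1 (τ : ℕ → Fin 2) :
    -- for each word, the value on its cylinder of an accumulation point of the empirical
    -- measures depends only on `τ` and on the word
    (∃ value : List Letter → ℝ,
      ∀ y ∈ recodedSet τ, ∀ n : ℕ → ℕ+, StrictMono n →
        ∀ ν : ProbabilityMeasure (ℤ → Letter),
          Tendsto (fun k => empiricalMeasure y (n k)) atTop (𝓝 ν) →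
          ∀ w : List Letter,
            ((ν (wordCylinder w) : ℝ≥0) : ℝ) = value w ∧
            Tendsto (fun k => (occurrences w y (n k) : ℝ) / ((n k : ℕ) : ℝ)) atTop
              (𝓝 (value w))) ∧
    -- there is exactly one measure for which all points are generic
    ∃ ν : ProbabilityMeasure (ℤ → Letter),
      (∀ y ∈ recodedSet τ, Tendsto (fun n => empiricalMeasure y n) atTop (𝓝 ν)) ∧
      (∀ ν' : ProbabilityMeasure (ℤ → Letter),
        (∀ y ∈ recodedSet τ, Tendsto (fun n => empiricalMeasure y n) atTop (𝓝 ν')) → ν' = ν) ∧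
      -- the subshift is uniquely ergodic, with unique invariant measure `ν`
      IsSubshift (recodedSet τ) ∧ invariantMeasures (recodedSet τ) = {ν} := by
  obtain ⟨v, hv⟩ := exists_frequency τ
  obtain ⟨ν, hν⟩ := exists_tendsto_empiricalMeasure hv
  obtain ⟨y₀, hy₀⟩ := recodedSet_nonempty τ
  refine ⟨⟨v, fun y hy n hn μ hμ w => ?_⟩, ν, hν,
    fun ν' hν' => tendsto_nhds_unique (hν' y₀ hy₀) (hν y₀ hy₀), isSubshift_recodedSet τ, ?_⟩
  · have hn' : Tendsto (fun k => (n k : ℕ)) atTop atTop :=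
      StrictMono.tendsto_atTop fun _ _ h => hn h
    exact ⟨apply_cylinderAt_of_tendsto hv hy hn' hμ 0 w, (tendsto_occurrences (hv y hy w)).comp hn'⟩
  · have hmem := mem_invariantMeasures_of_tendsto hv hy₀ (hν y₀ hy₀)
    refine Set.eq_singleton_iff_unique_mem.2 ⟨hmem, fun μ hμ => probabilityMeasure_ext fun i w => ?_⟩
    rw [← NNReal.coe_inj, apply_cylinderAt_of_invariant hv hμ,
      apply_cylinderAt_of_invariant hv hmem]
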